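/- **Theorem.** For $m,n\in\mathbb N$, closed convex sets $\mathcal X\subset\mathbb R^m$ with $0\in\mathcal X$ and nonempty $\mathcal Y\subset\mathbb R^n$, let $\mathcal F(L_f,L_g,\mu,\Delta)$, with constants $C,\rho\ge 0$, be the class of pairs $f,g:\mathcal X\times\mathcal Y\to\mathbb R$ such that: (1) $f$ and $g$ are continuously differentiable and jointly $L_f$- respectively $L_g$-smooth on $\mathcal X\times\mathcal Y$; (2) $\|\nabla_y f\|_2\le C$ on $\mathcal X\times\mathcal Y$; (3) $g(x;\cdot)$ is $\mu$-strongly convex on $\mathcal Y$ for every $x\in\mathcal X$; (4) $\nabla^2_{x,y}g$ and $\nabla^2_{y,y}g$ exist and are $\rho$-Lipschitz on $\mathcal X\times\mathcal Y$; (5) $H(0)-\min_{x\in\mathcal X}H(x)\le\Delta$, where $H(x):=f(x;y^*(x))$ and $y^*(x):=\arg\min_{y\in\mathcal Y}g(x;y)$. A stochastic first-order oracle for $f$ with variance at most $\sigma^2$ returns, at a point $z\in\mathcal X\times\mathcal Y$, the value $f(z)$ and a vector $G_f(z;\xi)$ with $\mathbb E_\xi G_f(z;\xi)=\nabla f(z)$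 and $\mathbb E_\xi\|G_f(z;\xi)-\nabla f(z)\|_2^2\le\sigma^2$; likewise for $g$. A (possibly randomized) zero-respecting algorithm starts at $(x^0,y^0)=(0,0)$, calls both oracles at $(x^i,y^i)$ with fresh independent randomness $\xi_f^i,\xi_g^i$ for $i=0,1,2,\dots$, and chooses, on the basis of what it has seen before, $x^{t+1}=\mathcal P_{\mathcal X}(u)$ and $y^{t+1}=\mathcal P_{\mathcal Y}(v)$, where $\mathcal P$ is the Euclidean projection and $$\operatorname{supp}(u)\subset\bigcup_{0\le i\le t}\bigl(\operatorname{supp}(x^i)\cup\operatorname{supp}(G_{f,x}(x^i,y^i;\xi_f^i))\cup\operatorname{supp}(G_{g,x}(x^i,y^i;\xi_g^i))\bigr),$$ $$\operatorname{supp}(v)\subset\bigcup_{0\le i\le t}\bigl(\operatorname{supp}(y^i)\cup\operatorname{supp}(G_{f,y}(x^i,y^i;\xi_f^i))\cup\operatorname{supp}(G_{g,y}(x^i,y^i;\xi_g^i))\bigr),$$ with $G_{\cdot,x}$, $G_{\cdot,y}$ the $x$- and $y$-parts of the oracle answers. For every $\kappa_0>1$ there are constants $c_0,c_1>0$ depending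 only on $\kappa_0$, and for every $B>0$ there are constants $K>0$, $\rho\ge0$ depending only on $\kappa_0$ and $B$, such that the following holds. Let $L_f,L_g,\mu,\Delta,\epsilon,\sigma>0$ with $\kappa:=L_g/\mu\ge\kappa_0$, $\Delta/L_f\le B$ and $\epsilon\le c_1\sqrt{\kappa L_f\Delta}$. Then there are $m,n\in\mathbb N$, hypercubes $\mathcal X=\{x\in\mathbb R^m:\|x\|_\infty\le R_x\}$ and $\mathcal Y=\{y\in\mathbb R^n:\|y\|_\infty\le R_y\}$ with $R_x,R_y>0$, functions $f,g:\mathcal X\times\mathcal Y\to\mathbb R$ with $\{f,g\}\in\mathcal F(L_f,L_g,\mu,\Delta)$ with constants $C=KL_f$ and $\rho$, and stochastic first-order oracles of variance at most $\sigma^2$ for $f$ and for $g$, such that $H$ is smooth on $\mathcal X$ (its gradient is Lipschitz) and, for every $L_h>0$ for which $H$ is $L_h$-smooth on $\mathcal X$, every zero-respecting algorithm and every $t$: if $$\mathbb E\bigl[L_h\|\mathcal P_{\mathcal X}[x^t-(1/L_h)\nabla H(x^t)]-x^t\|_2\bigr]<\epsilon,$$ then $$t\ \ge\ c_0\,\frac{L_f^3\,\Delta\,\kappa^{5/2}\,\sigma^2}{L_g^2\,\epsilon^4},$$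 where $t$ is the number of calls made to each of the two oracles before $x^t$ is produced. -/

import Mathlib

open MeasureTheory ProbabilityTheory
open scoped Gradient

namespace Bilevel

/-- The Euclidean space `ℝᵈ` with the `ℓ²` norm. -/
abbrev E (d : ℕ) : Type := EuclideanSpace ℝ (Fin d)

/-- The joint space `ℝᵐ × ℝⁿ` of upper- and lower-level variables, with the `ℓ²` norm of `ℝᵐ⁺ⁿ`. -/
abbrev Pt (m n : ℕ) : Type := WithLp 2 (E m × E n)

/-- The joint point `(x, y)`. -/
def pt {m n : ℕ} (x : E m) (y : E n) : Pt m n := WithLp.toLp 2 (x, y)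

/-- The domain `X × Y` inside the joint space. -/
def dom {m n : ℕ} (X : Set (E m)) (Y : Set (E n)) : Set (Pt m n) :=
  {z | z.fst ∈ X ∧ z.snd ∈ Y}

/-- The partial gradient in `x` at `z` (a block of the joint gradient). -/
noncomputable def gradX {m n : ℕ} (f : Pt m n → ℝ) (z : Pt m n) : E m := (∇ f z).fst

/-- The partial gradient in `y` at `z` (a block of the joint gradient). -/
noncomputable def gradY {m n : ℕ} (f : Pt m n → ℝ) (z : Pt m n) : E n := (∇ f z).snd

/-- The closed hypercube `{x : ‖x‖_∞ ≤ R}`. -/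
def cube (d : ℕ) (R : ℝ) : Set (E d) := {x | ∀ i, |x i| ≤ R}

/-- The support of a vector. -/
def supp {d : ℕ} (x : E d) : Set (Fin d) := {i | x i ≠ 0}

/-- The Euclidean projection onto a nonempty closed convex set `S`, i.e. the nearest point of `S`. -/
noncomputable def proj {d : ℕ} (S : Set (E d)) (u : E d) : E d :=
  Classical.epsilon fun p => p ∈ S ∧ ∀ q ∈ S, ‖u - p‖ ≤ ‖u - q‖

/-- The lower-level solution `y*(x)`, the minimizer of `g(x; ·)` over `Y`. -/
noncomputable def lowerSol {m n : ℕ} (g : Pt m n → ℝ) (Y : Set (E n)) (x : E m) : E n :=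
  Classical.epsilon fun y => y ∈ Y ∧ IsMinOn (fun y' => g (pt x y')) Y y

/-- The hyper-objective `H(x) = f(x; y*(x))`. -/
noncomputable def hyperObj {m n : ℕ} (f g : Pt m n → ℝ) (Y : Set (E n)) (x : E m) : ℝ :=
  f (pt x (lowerSol g Y x))

/-- `f` is `L`-smooth on `D`: differentiable at every point of `D`, with `L`-Lipschitz gradient
on `D` (so in particular the gradient is continuous there). -/
def IsSmooth {m n : ℕ} (f : Pt m n → ℝ) (D : Set (Pt m n)) (L : ℝ) : Prop :=
  (∀ z ∈ D, DifferentiableAt ℝ f z) ∧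
    ∀ z ∈ D, ∀ z' ∈ D, ‖∇ f z - ∇ f z'‖ ≤ L * ‖z - z'‖

/-- The class of smooth nonconvex-strongly-convex bilevel problems on `X × Y`. The functions are
given on the whole space, but only their behaviour on `X × Y` (with derivatives at the points of
`X × Y`) is restricted. `C` bounds `∇_y f` and `ρ` is the Lipschitz constant of the second
derivatives of `g`. -/
structure BilevelClass {m n : ℕ} (Lf Lg μ Δ C ρ : ℝ) (X : Set (E m)) (Y : Set (E n))
    (f g : Pt m n → ℝ) : Prop where
  closed_X : IsClosed X
  convex_X : Convex ℝ X
  zero_mem_X : (0 : E m) ∈ X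
  closed_Y : IsClosed Y
  convex_Y : Convex ℝ Y
  nonempty_Y : Y.Nonempty
  smooth_f : IsSmooth f (dom X Y) Lf
  smooth_g : IsSmooth g (dom X Y) Lg
  bounded_gradY : ∀ z ∈ dom X Y, ‖gradY f z‖ ≤ C
  strongly_convex : ∀ x ∈ X, ∀ y₁ ∈ Y, ∀ y₂ ∈ Y,
    g (pt x y₂) + inner ℝ (gradY g (pt x y₂)) (y₁ - y₂) + μ / 2 * ‖y₁ - y₂‖ ^ 2 ≤ g (pt x y₁)
  /- The derivative of `∇_y g` consists of the blocks `∇²_{x,y} g` and `∇²_{y,y} g`. -/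
  second_order : ∀ z ∈ dom X Y, DifferentiableAt ℝ (gradY g) z
  second_order_lipschitz : ∀ z ∈ dom X Y, ∀ z' ∈ dom X Y,
    ‖fderiv ℝ (gradY g) z - fderiv ℝ (gradY g) z'‖ ≤ ρ * ‖z - z'‖
  gap : ∃ x₀ ∈ X, IsMinOn (hyperObj f g Y) X x₀ ∧
    hyperObj f g Y 0 - hyperObj f g Y x₀ ≤ Δ

/-- The random part of a stochastic first-order oracle: a random seed with its law, and the
stochastic gradient returned at a query point. (The function value is returned exactly.) -/
structure StochasticOracle (m n : ℕ) where
  Seed : Type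
  [measurableSpaceSeed : MeasurableSpace Seed]
  law : Measure Seed
  [isProbabilityMeasure : IsProbabilityMeasure law]
  grad : Pt m n → Seed → Pt m n
  measurable_grad : Measurable (Function.uncurry grad)

attribute [instance] StochasticOracle.measurableSpaceSeed StochasticOracle.isProbabilityMeasure

/-- `O` is a stochastic first-order oracle for `f` on `D`: unbiased, with variance at most `σ²`. -/
structure StochasticOracle.IsOracleFor {m n : ℕ} (O : StochasticOracle m n) (f : Pt m n → ℝ)
    (D : Set (Pt m n)) (σ : ℝ) : Prop where
  integrable : ∀ z ∈ D, Integrable (O.grad z) O.law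
  unbiased : ∀ z ∈ D, ∫ s, O.grad z s ∂O.law = ∇ f z
  integrable_sq : ∀ z ∈ D, Integrable (fun s => ‖O.grad z s - ∇ f z‖ ^ 2) O.law
  variance_le : ∀ z ∈ D, ∫ s, ‖O.grad z s - ∇ f z‖ ^ 2 ∂O.law ≤ σ ^ 2

/-- A run of a zero-respecting first-order bilevel algorithm on `X × Y` with oracles `Of`, `Og`.
At step `t` the point `(x t, y t)` is submitted to both oracles, which answer with fresh seeds
`sf t`, `sg t`. The filtration `ℱ` carries what is known to the algorithm, including any internal
randomness: `ℱ t` is the information available before the seeds of step `t` are drawn. -/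
structure ZeroRespectingRun {m n : ℕ} (Of Og : StochasticOracle m n) (X : Set (E m)) (Y : Set (E n))
    {Ω : Type*} [mΩ : MeasurableSpace Ω] (P : Measure Ω) (ℱ : Filtration ℕ mΩ)
    (sf : ℕ → Ω → Of.Seed) (sg : ℕ → Ω → Og.Seed) (x : ℕ → Ω → E m) (y : ℕ → Ω → E n) : Prop where
  adapted_x : ∀ t, Measurable[ℱ t] (x t)
  adapted_y : ∀ t, Measurable[ℱ t] (y t)
  measurable_sf : ∀ t, Measurable[ℱ (t + 1)] (sf t)
  measurable_sg : ∀ t, Measurable[ℱ (t + 1)] (sg t)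
  fresh : ∀ t, Indep (MeasurableSpace.comap (fun ω => (sf t ω, sg t ω)) inferInstance) (ℱ t) P
  law_seeds : ∀ t, P.map (fun ω => (sf t ω, sg t ω)) = Of.law.prod Og.law
  init_x : ∀ ω, x 0 ω = 0
  init_y : ∀ ω, y 0 ω = 0
  step_x : ∀ t, ∀ᵐ ω ∂P, ∃ u : E m, x (t + 1) ω = proj X u ∧
    supp u ⊆ ⋃ i ∈ Set.Iic t, (supp (x i ω) ∪ supp (Of.grad (pt (x i ω) (y i ω)) (sf i ω)).fst ∪
      supp (Og.grad (pt (x i ω) (y i ω)) (sg i ω)).fst)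
  step_y : ∀ t, ∀ᵐ ω ∂P, ∃ v : E n, y (t + 1) ω = proj Y v ∧
    supp v ⊆ ⋃ i ∈ Set.Iic t, (supp (y i ω) ∪ supp (Of.grad (pt (x i ω) (y i ω)) (sf i ω)).snd ∪
      supp (Og.grad (pt (x i ω) (y i ω)) (sg i ω)).snd)

/-- `H` is `L`-smooth on `X`: differentiable on `X` with `L`-Lipschitz gradient. Derivatives are
taken within `X`, because `H` is a function on `X` only. -/
def IsSmoothOn {m : ℕ} (H : E m → ℝ) (X : Set (E m)) (L : ℝ) : Prop :=
  DifferentiableOn ℝ H X ∧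
    ∀ x ∈ X, ∀ x' ∈ X, ‖gradientWithin H X x - gradientWithin H X x'‖ ≤ L * ‖x - x'‖

/-- The norm `L ‖P_X[x - (1/L) ∇H(x)] - x‖` of the projected gradient mapping. -/
noncomputable def gradMapNorm {m : ℕ} (H : E m → ℝ) (X : Set (E m)) (L : ℝ) (x : E m) : ℝ :=
  L * ‖proj X (x - (1 / L) • gradientWithin H X x) - x‖

end Bilevel

namespace Bilevel

/-! The instance is a chain whose links alternate between the two levels. In `chainF`, the
coordinate `x (j+1)` gets a nonzero partial derivative only once `y j` is active. In `lowerG`, the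
coordinate `y j` gets one only once `x j` is active. The lower-level solution is `α • x`, with `α`
proportional to `κ`. Hence `f` varies on the scale `s` in `x` but on the larger scale `α * s` in `y`
when `κ` is large, which keeps `f` smooth even for small `s`.

All noise sits in the oracle of `g`: the `y`-derivative at the last active coordinate of `x` is
multiplied by `1/p` with probability `p` and by `0` otherwise. This is unbiased, and since only one
coordinate is affected, its variance does not grow with the dimension. Without a success the chain
cannot advance (`InactiveFrom.noisyGrad`), so after `t` calls its progress is at most the number of
successes (`ZeroRespectingRun.ae_inactiveFrom`), whose mean is `t * p`.

While the last coordinate of `x` is zero, some coordinate of `∇H` is at most `-lam/(4s)` at a place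
where the box leaves room to move, so the gradient mapping has norm at least `lam/(4s) = 2ε`
(`exists_chainHGrad_le`, `le_gradMapNorm`). A Markov-type bound then makes its expectation at least
`2ε (1 - t p / N)`, and an expectation below `ε` forces `t > N/(2p)`. Here `N` is of order `Δ/lam`
and `p` is at most `b²/σ²`, where `b` is of order `α μ s`. The resulting bound has `κ³` in place of
`κ^(5/2)`, which is stronger because `κ ≥ 1`. -/

/-! ### The squared positive part -/

/-- The squared positive part of a real number. -/
def sqPos (u : ℝ) : ℝ := max u 0 ^ 2

/-- Value and derivative both vanish at `0`, so an inactive coordinate of `y` reveals nothing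
through `f`; the derivative is Lipschitz, which is all the regularity `f` needs. -/
lemma hasDerivAt_sqPos (u : ℝ) : HasDerivAt sqPos (2 * max u 0) u := by
  rcases lt_trichotomy u 0 with h | h | h
  · have : sqPos =ᶠ[nhds u] fun _ => 0 := by
      filter_upwards [Iio_mem_nhds h] with v hv
      simp [sqPos, max_eq_right (le_of_lt (Set.mem_Iio.1 hv))]
    simpa [max_eq_right h.le] using (hasDerivAt_const u (0 : ℝ)).congr_of_eventuallyEq this
  · subst h
    rw [hasDerivAt_iff_isLittleO]
    have h1 : (fun v : ℝ => v ^ 2) =o[nhds 0] fun v : ℝ => v := by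
      simpa using Asymptotics.isLittleO_pow_pow (𝕜 := ℝ) (m := 1) (n := 2) (by norm_num)
    refine (Asymptotics.IsBigO.of_bound 1 (Filter.Eventually.of_forall fun v => ?_)).trans_isLittleO
      (h1.congr_right fun v => (sub_zero v).symm)
    have h2 : |max v 0| ≤ |v| := by
      rw [abs_of_nonneg (le_max_right _ _)]
      exact max_le (le_abs_self v) (abs_nonneg v)
    have h3 := sq_le_sq.2 h2
    simpa [sqPos] using h3
  · have : sqPos =ᶠ[nhds u] fun v => v ^ 2 := by
      filter_upwards [Ioi_mem_nhds h] with v hv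
      simp [sqPos, max_eq_left (le_of_lt (Set.mem_Ioi.1 hv))]
    simpa [max_eq_left h.le] using ((hasDerivAt_id u).pow 2).congr_of_eventuallyEq this

@[simp] lemma sqPos_zero : sqPos 0 = 0 := by simp [sqPos]

@[simp] lemma sqPos_one : sqPos 1 = 1 := by simp [sqPos]

lemma sqPos_le_one {u : ℝ} (h : u ≤ 1) : sqPos u ≤ 1 :=
  pow_le_one₀ (le_max_right _ _) (max_le h zero_le_one)

lemma abs_max_zero_sub_le (u v : ℝ) : |max u 0 - max v 0| ≤ |u - v| := by
  simpa using abs_max_sub_max_le_abs u v 0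

lemma abs_sqPos_sub_le {u v : ℝ} (hu : u ≤ 1) (hv : v ≤ 1) :
    |sqPos u - sqPos v| ≤ 2 * |u - v| := by
  have h1 : sqPos u - sqPos v = (max u 0 + max v 0) * (max u 0 - max v 0) := by
    unfold sqPos; ring
  have hu' : max u 0 ≤ 1 := max_le hu zero_le_one
  have hv' : max v 0 ≤ 1 := max_le hv zero_le_one
  have h2 : |max u 0 + max v 0| ≤ 2 := by
    rw [abs_of_nonneg (add_nonneg (le_max_right _ _) (le_max_right _ _))]; linarith
  rw [h1, abs_mul]
  exact mul_le_mul h2 (abs_max_zero_sub_le u v) (abs_nonneg _) zero_le_two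

/-! ### The joint space -/

section Joint

variable {m n : ℕ}

@[simp] lemma pt_fst (x : E m) (y : E n) : (pt x y).fst = x := rfl

@[simp] lemma pt_snd (x : E m) (y : E n) : (pt x y).snd = y := rfl

lemma norm_sq_joint (z : Pt m n) : ‖z‖ ^ 2 = ∑ i, z.fst i ^ 2 + ∑ j, z.snd j ^ 2 := by
  rw [WithLp.prod_norm_sq_eq_of_L2, EuclideanSpace.real_norm_sq_eq, EuclideanSpace.real_norm_sq_eq]

lemma inner_joint (z w : Pt m n) :
    inner ℝ z w = ∑ i, z.fst i * w.fst i + ∑ j, z.snd j * w.snd j := by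
  rw [WithLp.prod_inner_apply]
  simp [PiLp.inner_apply, mul_comm]

/-- The `i`-th coordinate of the upper-level variable. -/
noncomputable def coordX (i : Fin m) : Pt m n →L[ℝ] ℝ :=
  (EuclideanSpace.proj i).comp (WithLp.fstL 2 ℝ (E m) (E n))

/-- The `j`-th coordinate of the lower-level variable. -/
noncomputable def coordY (j : Fin n) : Pt m n →L[ℝ] ℝ :=
  (EuclideanSpace.proj j).comp (WithLp.sndL 2 ℝ (E m) (E n))

@[simp] lemma coordX_apply (i : Fin m) (z : Pt m n) : coordX i z = z.fst i := rfl

@[simp] lemma coordY_apply (j : Fin n) (z : Pt m n) : coordY j z = z.snd j := rfl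

lemma hasGradientAt_of_fderiv {f : Pt m n → ℝ} {f' : Pt m n →L[ℝ] ℝ} {G z : Pt m n}
    (h : HasFDerivAt f f' z)
    (hG : ∀ w, f' w = ∑ i, G.fst i * w.fst i + ∑ j, G.snd j * w.snd j) :
    HasGradientAt f G z := by
  rw [hasGradientAt_iff_hasFDerivAt]
  refine h.congr_fderiv (ContinuousLinearMap.ext fun w => ?_)
  rw [hG, InnerProductSpace.toDual_apply_apply, inner_joint]

/-- The gradient of a function along the graph of `x ↦ α x`. -/
lemma hasGradientAt_graph {f : Pt n n → ℝ} {G : Pt n n} {α : ℝ} {x : E n}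
    (h : HasGradientAt f G (pt x (α • x))) :
    HasGradientAt (fun x => f (pt x (α • x))) (G.fst + α • G.snd) x := by
  rw [hasGradientAt_iff_hasFDerivAt] at h ⊢
  let A : E n →L[ℝ] Pt n n := ((WithLp.prodContinuousLinearEquiv 2 ℝ (E n) (E n)).symm :
    (E n × E n) →L[ℝ] Pt n n).comp ((ContinuousLinearMap.id ℝ (E n)).prod (α • .id ℝ (E n)))
  have hA : ∀ x, A x = pt x (α • x) := fun x => rfl
  have h1 : HasFDerivAt f (InnerProductSpace.toDual ℝ _ G) (A x) := h
  refine (h1.comp x A.hasFDerivAt).congr_fderiv (ContinuousLinearMap.ext fun w => ?_)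
  simp [hA, WithLp.prod_inner_apply, pt, inner_smul_right]

lemma IsSmooth.of_hasGradientAt {f : Pt m n → ℝ} {G : Pt m n → Pt m n} {D : Set (Pt m n)} {L : ℝ}
    (h : ∀ z, HasGradientAt f (G z) z)
    (hL : ∀ z ∈ D, ∀ z' ∈ D, ‖G z - G z'‖ ≤ L * ‖z - z'‖) : IsSmooth f D L := by
  refine ⟨fun z _ => (h z).differentiableAt, fun z hz z' hz' => ?_⟩
  rw [(h z).gradient, (h z').gradient]
  exact hL z hz z' hz'

end Joint

/-! ### The upper-level chain function -/

section Chain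

variable {N : ℕ} (lam s r : ℝ)

/-- The upper-level function: the `j`-th lower-level coordinate drives the `(j+1)`-st upper-level
coordinate. -/
noncomputable def chainF (z : Pt (N + 1) (N + 1)) : ℝ :=
  -(lam * ((1 + z.fst 0 / s) +
    ∑ j : Fin N, sqPos (z.snd j.castSucc / r) * (1 + z.fst j.succ / s)))

/-- The gradient of `chainF`. -/
noncomputable def chainGrad (z : Pt (N + 1) (N + 1)) : Pt (N + 1) (N + 1) :=
  pt (WithLp.toLp 2 (Fin.cons (-(lam / s)) fun j : Fin N =>
      -(lam / s * sqPos (z.snd j.castSucc / r))))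
    (WithLp.toLp 2 (Fin.snoc (α := fun _ => ℝ) (fun j : Fin N =>
      -(2 * lam / r * (max (z.snd j.castSucc / r) 0 * (1 + z.fst j.succ / s)))) 0))

@[simp] lemma chainGrad_fst_zero (z : Pt (N + 1) (N + 1)) :
    (chainGrad lam s r z).fst 0 = -(lam / s) := rfl

@[simp] lemma chainGrad_fst_succ (z : Pt (N + 1) (N + 1)) (j : Fin N) :
    (chainGrad lam s r z).fst j.succ = -(lam / s * sqPos (z.snd j.castSucc / r)) := rfl

@[simp] lemma chainGrad_snd_castSucc (z : Pt (N + 1) (N + 1)) (j : Fin N) :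
    (chainGrad lam s r z).snd j.castSucc =
      -(2 * lam / r * (max (z.snd j.castSucc / r) 0 * (1 + z.fst j.succ / s))) := by
  simp [chainGrad]

@[simp] lemma chainGrad_snd_last (z : Pt (N + 1) (N + 1)) :
    (chainGrad lam s r z).snd (Fin.last N) = 0 := by
  simp [chainGrad]

lemma hasGradientAt_chainF (z : Pt (N + 1) (N + 1)) :
    HasGradientAt (chainF lam s r) (chainGrad lam s r z) z := by
  have hX : ∀ i : Fin (N + 1), HasFDerivAt (fun z : Pt (N + 1) (N + 1) => 1 + z.fst i / s)
      (s⁻¹ • coordX i) z := fun i => by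
    have := ((coordX (n := N + 1) i).hasFDerivAt (x := z)).const_mul s⁻¹
    refine (this.const_add 1).congr_of_eventuallyEq (Filter.Eventually.of_forall fun w => ?_)
    exact congrArg (1 + ·) (div_eq_inv_mul _ _)
  have hY : ∀ i : Fin (N + 1), HasFDerivAt (fun z : Pt (N + 1) (N + 1) => sqPos (z.snd i / r))
      ((2 * max (z.snd i / r) 0) • (r⁻¹ • coordY i)) z := fun i => by
    have h1 := ((coordY (m := N + 1) i).hasFDerivAt (x := z)).const_mul r⁻¹
    have h2 := (hasDerivAt_sqPos (r⁻¹ * coordY i z)).comp_hasFDerivAt z h1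
    rw [div_eq_inv_mul]
    exact h2.congr_of_eventuallyEq
      (Filter.Eventually.of_forall fun w => congrArg sqPos (div_eq_inv_mul _ _))
  have hs := ((hX 0).add (HasFDerivAt.fun_sum (u := Finset.univ)
    fun (j : Fin N) _ => (hY j.castSucc).mul (hX j.succ))).const_mul lam |>.neg
  refine hasGradientAt_of_fderiv hs fun w => ?_
  rw [Fin.sum_univ_succ, Fin.sum_univ_castSucc]
  simp only [chainGrad_fst_zero, chainGrad_fst_succ, chainGrad_snd_castSucc, chainGrad_snd_last,
    neg_apply, smul_apply, add_apply, sum_apply, coordX_apply, coordY_apply, smul_eq_mul,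
    zero_mul, add_zero]
  rw [add_assoc, ← Finset.sum_add_distrib, mul_add, neg_add, Finset.mul_sum,
    ← Finset.sum_neg_distrib]
  congr 1
  · ring
  · exact Finset.sum_congr rfl fun j _ => by ring

variable {lam s r}

lemma div_mem_of_mem_cube {d : ℕ} {R : ℝ} (hR : 0 < R) {x : E d} (hx : x ∈ cube d R) (i : Fin d) :
    -1 ≤ x i / R ∧ x i / R ≤ 1 := by
  have h := abs_le.1 (hx i)
  rw [le_div_iff₀ hR, div_le_iff₀ hR]
  constructor <;> linarith

/-- Each gradient entry depends on at most the one pair `(y j, x (j+1))`, so squared differences add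
up with no factor of the dimension. The sum requires `12 a² + 32 b² ≤ L²`, which follows from `6a +
6b ≤ L`. -/
lemma chainGrad_lipschitz (hlam : 0 < lam) (hs : 0 < s) (hr : 0 < r) {L : ℝ}
    (hL : lam / s / r * 6 + lam / r ^ 2 * 6 ≤ L) (z z' : Pt (N + 1) (N + 1))
    (hz : z ∈ dom (cube (N + 1) s) (cube (N + 1) r))
    (hz' : z' ∈ dom (cube (N + 1) s) (cube (N + 1) r)) :
    ‖chainGrad lam s r z - chainGrad lam s r z'‖ ≤ L * ‖z - z'‖ := by
  set a := lam / s / r with ha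
  set b := lam / r ^ 2 with hb
  have ha0 : 0 < a := by positivity
  have hb0 : 0 < b := by positivity
  have hL0 : 0 ≤ L := by linarith
  refine abs_le_of_sq_le_sq' ?_ (by positivity) |>.2
  rw [mul_pow, norm_sq_joint, norm_sq_joint]
  have hx : ∀ j : Fin N,
      ((chainGrad lam s r z - chainGrad lam s r z').fst j.succ) ^ 2 ≤
        4 * a ^ 2 * ((z - z').snd j.castSucc) ^ 2 := fun j => by
    have h1 := abs_sqPos_sub_le (div_mem_of_mem_cube hr hz.2 j.castSucc).2
      (div_mem_of_mem_cube hr hz'.2 j.castSucc).2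
    have h2 : (chainGrad lam s r z - chainGrad lam s r z').fst j.succ = -(lam / s *
      (sqPos (z.snd j.castSucc / r) - sqPos (z'.snd j.castSucc / r))) := by
      rw [WithLp.sub_fst, PiLp.sub_apply, chainGrad_fst_succ, chainGrad_fst_succ]; ring
    have h3 : 4 * a ^ 2 * ((z - z').snd j.castSucc) ^ 2 =
        (lam / s * (2 * (z.snd j.castSucc / r - z'.snd j.castSucc / r))) ^ 2 := by
      rw [WithLp.sub_snd, PiLp.sub_apply, ha]; field_simp; ring
    rw [h2, h3, sq_le_sq, abs_neg, abs_mul, abs_mul, abs_mul, abs_two]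
    gcongr
  have hy : ∀ j : Fin N,
      ((chainGrad lam s r z - chainGrad lam s r z').snd j.castSucc) ^ 2 ≤
        32 * b ^ 2 * ((z - z').snd j.castSucc) ^ 2 + 8 * a ^ 2 * ((z - z').fst j.succ) ^ 2 :=
      fun j => by
    set u := z.snd j.castSucc / r with hu
    set u' := z'.snd j.castSucc / r with hu'
    set v := z.fst j.succ / s with hv
    set v' := z'.fst j.succ / s with hv'
    have hv1 := div_mem_of_mem_cube hs hz.1 j.succ
    have hu1 := div_mem_of_mem_cube hr hz'.2 j.castSucc
    have h2 : (chainGrad lam s r z - chainGrad lam s r z').snd j.castSucc =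
        -(2 * lam / r * ((1 + v) * (max u 0 - max u' 0) + max u' 0 * (v - v'))) := by
      rw [WithLp.sub_snd, PiLp.sub_apply, chainGrad_snd_castSucc, chainGrad_snd_castSucc]; ring
    have h3 : ((1 + v) * (max u 0 - max u' 0) + max u' 0 * (v - v')) ^ 2 ≤
        8 * (u - u') ^ 2 + 2 * (v - v') ^ 2 := by
      have e1 : (max u 0 - max u' 0) ^ 2 ≤ (u - u') ^ 2 := sq_le_sq.2 (abs_max_zero_sub_le u u')
      have e2 : (1 + v) ^ 2 ≤ 2 ^ 2 := by
        refine pow_le_pow_left₀ (by linarith [hv1.1]) (by linarith [hv1.2]) 2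
      have e3 : max u' 0 ^ 2 ≤ 1 := sqPos_le_one hu1.2
      have e4 : (1 + v) ^ 2 * (max u 0 - max u' 0) ^ 2 ≤ 2 ^ 2 * (u - u') ^ 2 := by gcongr
      have e5 : max u' 0 ^ 2 * (v - v') ^ 2 ≤ 1 * (v - v') ^ 2 := by gcongr
      nlinarith [sq_nonneg ((1 + v) * (max u 0 - max u' 0) - max u' 0 * (v - v'))]
    have h4 : 32 * b ^ 2 * ((z - z').snd j.castSucc) ^ 2 + 8 * a ^ 2 * ((z - z').fst j.succ) ^ 2 =
        (2 * lam / r) ^ 2 * (8 * (u - u') ^ 2 + 2 * (v - v') ^ 2) := by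
      rw [WithLp.sub_snd, PiLp.sub_apply, WithLp.sub_fst, PiLp.sub_apply, ha, hb, hu, hu', hv, hv']
      field_simp; ring
    rw [h2, h4, neg_sq, mul_pow]
    gcongr
  have hX : ∑ i, ((chainGrad lam s r z - chainGrad lam s r z').fst i) ^ 2 ≤
      4 * a ^ 2 * ∑ j, ((z - z').snd j) ^ 2 := by
    rw [Fin.sum_univ_succ, Fin.sum_univ_castSucc (f := fun j => ((z - z').snd j) ^ 2)]
    have h0 : (chainGrad lam s r z - chainGrad lam s r z').fst 0 = 0 := by
      rw [WithLp.sub_fst, PiLp.sub_apply, chainGrad_fst_zero, chainGrad_fst_zero, sub_self]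
    rw [h0, mul_add, Finset.mul_sum]
    have := Finset.sum_le_sum fun j (_ : j ∈ Finset.univ) => hx j
    have := mul_nonneg (mul_nonneg zero_le_four (sq_nonneg a))
      (sq_nonneg ((z - z').snd (Fin.last N)))
    linarith
  have hY : ∑ i, ((chainGrad lam s r z - chainGrad lam s r z').snd i) ^ 2 ≤
      32 * b ^ 2 * ∑ j, ((z - z').snd j) ^ 2 + 8 * a ^ 2 * ∑ j, ((z - z').fst j) ^ 2 := by
    rw [Fin.sum_univ_castSucc, Fin.sum_univ_castSucc (f := fun j => ((z - z').snd j) ^ 2),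
      Fin.sum_univ_succ (f := fun j => ((z - z').fst j) ^ 2)]
    have h0 : (chainGrad lam s r z - chainGrad lam s r z').snd (Fin.last N) = 0 := by
      rw [WithLp.sub_snd, PiLp.sub_apply, chainGrad_snd_last, chainGrad_snd_last, sub_self]
    rw [h0, mul_add, mul_add, Finset.mul_sum, Finset.mul_sum]
    have h1 := Finset.sum_le_sum fun j (_ : j ∈ Finset.univ) => hy j
    rw [Finset.sum_add_distrib] at h1
    have := mul_nonneg (mul_nonneg (by norm_num : (0 : ℝ) ≤ 32) (sq_nonneg b))
      (sq_nonneg ((z - z').snd (Fin.last N)))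
    have := mul_nonneg (mul_nonneg (by norm_num : (0 : ℝ) ≤ 8) (sq_nonneg a))
      (sq_nonneg ((z - z').fst 0))
    linarith
  have hL2 : 12 * a ^ 2 + 32 * b ^ 2 ≤ L ^ 2 := by
    have : (a * 6 + b * 6) ^ 2 ≤ L ^ 2 := pow_le_pow_left₀ (by positivity) hL 2
    nlinarith [mul_pos ha0 hb0, sq_nonneg a, sq_nonneg b]
  have hS1 : 0 ≤ ∑ j, ((z - z').snd j) ^ 2 := Finset.sum_nonneg fun _ _ => sq_nonneg _
  have hS2 : 0 ≤ ∑ j, ((z - z').fst j) ^ 2 := Finset.sum_nonneg fun _ _ => sq_nonneg _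
  nlinarith [mul_le_mul_of_nonneg_right hL2 hS1, mul_le_mul_of_nonneg_right hL2 hS2, sq_nonneg a,
    sq_nonneg b, mul_nonneg (sq_nonneg a) hS2, mul_nonneg (sq_nonneg b) hS2,
    mul_nonneg (sq_nonneg a) hS1]

/-- The factor `N` is harmless because `lam * N` is later bounded by a multiple of `Δ`. -/
lemma norm_chainGrad_snd_le (hlam : 0 < lam) (hs : 0 < s) (hr : 0 < r) {z : Pt (N + 1) (N + 1)}
    (hz : z ∈ dom (cube (N + 1) s) (cube (N + 1) r)) :
    ‖(chainGrad lam s r z).snd‖ ^ 2 ≤ N * (4 * lam / r) ^ 2 := by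
  rw [EuclideanSpace.real_norm_sq_eq, Fin.sum_univ_castSucc, chainGrad_snd_last]
  have h : ∀ j : Fin N, ((chainGrad lam s r z).snd j.castSucc) ^ 2 ≤ (4 * lam / r) ^ 2 :=
      fun j => by
    have hu := div_mem_of_mem_cube hr hz.2 j.castSucc
    have hv := div_mem_of_mem_cube hs hz.1 j.succ
    rw [chainGrad_snd_castSucc, neg_sq]
    have h1 : max (z.snd j.castSucc / r) 0 ≤ 1 := max_le hu.2 zero_le_one
    have h2 : (0 : ℝ) ≤ max (z.snd j.castSucc / r) 0 := le_max_right _ _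
    have h3 : 0 ≤ 1 + z.fst j.succ / s := by linarith
    refine pow_le_pow_left₀ (by positivity) ?_ 2
    calc _ ≤ 2 * lam / r * (1 * 2) := by gcongr; linarith
      _ = 4 * lam / r := by ring
  simpa using Finset.sum_le_sum fun j (_ : j ∈ Finset.univ) => h j

lemma measurable_chainGrad : Measurable (chainGrad (N := N) lam s r) := by
  have hx : ∀ i : Fin (N + 1), Measurable fun z : Pt (N + 1) (N + 1) => z.fst i :=
    fun i => (coordX i).measurable
  have hy : ∀ i : Fin (N + 1), Measurable fun z : Pt (N + 1) (N + 1) => z.snd i :=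
    fun i => (coordY i).measurable
  refine (WithLp.measurable_toLp 2 _).comp (Measurable.prodMk ?_ ?_) <;>
    refine (WithLp.measurable_toLp 2 _).comp (measurable_pi_lambda _ fun i => ?_)
  · refine Fin.cases ?_ (fun j => ?_) i
    · exact measurable_const
    · simp only [Fin.cons_succ, sqPos]
      have := hy j.castSucc
      fun_prop
  · refine Fin.lastCases ?_ (fun j => ?_) i
    · simp
    · simp only [Fin.snoc_castSucc]
      have := hy j.castSucc
      have := hx j.succ
      fun_prop

end Chain

/-! ### Projection onto a cube -/

section Cube

variable {d : ℕ} {R : ℝ}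

/-- Coordinatewise truncation to `[-R, R]`. -/
def clamp (R : ℝ) (u : E d) : E d := WithLp.toLp 2 fun i => max (-R) (min (u i) R)

@[simp] lemma clamp_apply (u : E d) (i : Fin d) : clamp R u i = max (-R) (min (u i) R) := rfl

lemma clamp_mem_cube (hR : 0 ≤ R) (u : E d) : clamp R u ∈ cube d R := fun i => by
  rw [clamp_apply, abs_le]
  exact ⟨le_max_left _ _, max_le (by linarith) (min_le_right _ _)⟩

/-- The obtuse-angle inequality for projection onto an interval. Summed over coordinates it yields
both optimality and uniqueness of the truncated point, which pins down the choice made in `proj`. -/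
lemma sq_clamp_add_le {R p : ℝ} (hp : |p| ≤ R) (u : ℝ) :
    (u - max (-R) (min u R)) ^ 2 + (p - max (-R) (min u R)) ^ 2 ≤ (u - p) ^ 2 := by
  obtain ⟨h1, h2⟩ := abs_le.1 hp
  rcases le_total u R with h | h
  · rw [min_eq_left h]
    rcases le_total (-R) u with h' | h'
    · rw [max_eq_right h']; nlinarith
    · rw [max_eq_left h']; nlinarith
  · rw [min_eq_right h, max_eq_right (by linarith)]; nlinarith

lemma proj_cube (hR : 0 ≤ R) (u : E d) : proj (cube d R) u = clamp R u := by
  have key : ∀ q ∈ cube d R, ‖u - clamp R u‖ ^ 2 + ‖q - clamp R u‖ ^ 2 ≤ ‖u - q‖ ^ 2 :=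
      fun q hq => by
    rw [EuclideanSpace.real_norm_sq_eq, EuclideanSpace.real_norm_sq_eq,
      EuclideanSpace.real_norm_sq_eq, ← Finset.sum_add_distrib]
    exact Finset.sum_le_sum fun i _ => sq_clamp_add_le (hq i) (u i)
  have hex : ∃ p, p ∈ cube d R ∧ ∀ q ∈ cube d R, ‖u - p‖ ≤ ‖u - q‖ :=
    ⟨clamp R u, clamp_mem_cube hR u, fun q hq =>
      abs_le_of_sq_le_sq' (by linarith [key q hq, sq_nonneg ‖q - clamp R u‖])
        (norm_nonneg _) |>.2⟩
  obtain ⟨h1, h2⟩ := Classical.epsilon_spec hex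
  have h3 := key _ h1
  have h4 := pow_le_pow_left₀ (norm_nonneg _) (h2 _ (clamp_mem_cube hR u)) 2
  have h5 : ‖proj (cube d R) u - clamp R u‖ ^ 2 ≤ 0 := by
    unfold proj; linarith
  exact sub_eq_zero.1 (norm_eq_zero.1 (pow_eq_zero_iff two_ne_zero |>.1
    (le_antisymm h5 (sq_nonneg _))))

lemma continuous_clamp : Continuous (clamp R : E d → E d) := by
  refine (PiLp.continuous_toLp 2 _).comp (continuous_pi fun i => ?_)
  fun_prop

lemma isClosed_cube : IsClosed (cube d R) := by
  have : cube d R = ⋂ i, {x : E d | |x i| ≤ R} := by ext; simp [cube]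
  rw [this]
  exact isClosed_iInter fun i => isClosed_le (by fun_prop) continuous_const

lemma convex_cube : Convex ℝ (cube d R) := fun x hx y hy a b ha hb hab i => by
  have := hx i
  have := hy i
  calc |(a • x + b • y) i| ≤ |a * x i| + |b * y i| := by simpa using abs_add_le (a * x i) (b * y i)
    _ = a * |x i| + b * |y i| := by rw [abs_mul, abs_mul, abs_of_nonneg ha, abs_of_nonneg hb]
    _ ≤ a * R + b * R := by gcongr
    _ = R := by rw [← add_mul, hab, one_mul]

lemma zero_mem_cube (hR : 0 ≤ R) : (0 : E d) ∈ cube d R := fun i => by simpa using hR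

lemma isCompact_cube : IsCompact (cube d R) := by
  refine Metric.isCompact_of_isClosed_isBounded isClosed_cube ?_
  rw [isBounded_iff_forall_norm_le]
  refine ⟨√(d * R ^ 2), fun x hx => Real.le_sqrt_of_sq_le ?_⟩
  rw [EuclideanSpace.real_norm_sq_eq]
  have := Finset.sum_le_sum fun i (_ : i ∈ Finset.univ) => sq_le_sq' (abs_le.1 (hx i)).1
    (abs_le.1 (hx i)).2
  simpa using this

lemma uniqueDiffOn_cube (hR : 0 < R) : UniqueDiffOn ℝ (cube d R) := by
  refine uniqueDiffOn_convex convex_cube ⟨0, mem_interior.2 ⟨{x | ∀ i, |x i| < R}, ?_, ?_, ?_⟩⟩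
  · exact fun x hx i => (hx i).le
  · have : {x : E d | ∀ i, |x i| < R} = ⋂ i, {x : E d | |x i| < R} := by ext; simp
    rw [this]
    exact isOpen_iInter_of_finite fun i => isOpen_lt (by fun_prop) continuous_const
  · simpa using fun _ => hR

lemma smul_mem_cube {α : ℝ} (hα : 0 ≤ α) {x : E d} (hx : x ∈ cube d R) :
    α • x ∈ cube d (α * R) := fun i => by
  have := hx i
  rw [PiLp.smul_apply, smul_eq_mul, abs_mul, abs_of_nonneg hα]
  gcongr

/-- Truncation never enlarges the support. -/
lemma clamp_apply_eq_zero (hR : 0 ≤ R) {u : E d} {i : Fin d} (h : u i = 0) : clamp R u i = 0 := by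
  rw [clamp_apply, h, min_eq_left hR, max_eq_right (by linarith)]

end Cube

/-! ### The lower-level function -/

section Lower

variable {d : ℕ} (μ β : ℝ)

/-- The lower-level function `μ/2 ‖y‖² - β ⟪x, y⟫`. -/
noncomputable def lowerG (z : Pt d d) : ℝ :=
  ∑ j, (μ / 2 * z.snd j ^ 2 - β * (z.fst j * z.snd j))

/-- The gradient of `lowerG`. -/
noncomputable def lowerGrad (z : Pt d d) : Pt d d :=
  pt (-β • z.snd) (μ • z.snd - β • z.fst)

lemma hasGradientAt_lowerG (z : Pt d d) : HasGradientAt (lowerG μ β) (lowerGrad μ β z) z := by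
  have hX : ∀ i : Fin d, HasFDerivAt (fun z : Pt d d => z.fst i) (coordX i) z :=
    fun i => (coordX i).hasFDerivAt
  have hY : ∀ i : Fin d, HasFDerivAt (fun z : Pt d d => z.snd i) (coordY i) z :=
    fun i => (coordY i).hasFDerivAt
  have h := HasFDerivAt.fun_sum (u := Finset.univ) fun (j : Fin d) _ =>
    (((hY j).pow 2).const_mul (μ / 2)).sub (((hX j).mul (hY j)).const_mul β)
  refine hasGradientAt_of_fderiv h fun w => ?_
  rw [← Finset.sum_add_distrib, sum_apply]
  refine Finset.sum_congr rfl fun j _ => ?_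
  simp [lowerGrad]
  ring

variable {μ β}

lemma norm_lowerGrad_le (hμ : 0 ≤ μ) (hβ : 0 ≤ β) (z : Pt d d) :
    ‖lowerGrad μ β z‖ ≤ (μ + β) * ‖z‖ := by
  refine abs_le_of_sq_le_sq' ?_ (by positivity) |>.2
  rw [mul_pow, norm_sq_joint, norm_sq_joint, ← Finset.sum_add_distrib, ← Finset.sum_add_distrib,
    Finset.mul_sum]
  refine Finset.sum_le_sum fun i _ => ?_
  simp only [lowerGrad, pt_fst, pt_snd, PiLp.smul_apply, PiLp.sub_apply, smul_eq_mul]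
  nlinarith [mul_nonneg (mul_nonneg hμ hβ) (sq_nonneg (z.fst i + z.snd i)),
    mul_nonneg (mul_nonneg hμ hβ) (sq_nonneg (z.snd i)), mul_nonneg (mul_nonneg hμ hβ)
    (sq_nonneg (z.fst i)), mul_nonneg (mul_nonneg hμ hμ) (sq_nonneg (z.fst i))]

lemma lowerGrad_sub (z z' : Pt d d) :
    lowerGrad μ β z - lowerGrad μ β z' = lowerGrad μ β (z - z') := by
  refine WithLp.ofLp_injective 2 (Prod.ext ?_ ?_)
  · change -β • z.snd - -β • z'.snd = -β • (z.snd - z'.snd)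
    module
  · change (μ • z.snd - β • z.fst) - (μ • z'.snd - β • z'.fst) =
      μ • (z.snd - z'.snd) - β • (z.fst - z'.fst)
    module

lemma gradY_lowerG (z : Pt d d) : gradY (lowerG μ β) z = μ • z.snd - β • z.fst := by
  rw [gradY, (hasGradientAt_lowerG μ β z).gradient]; rfl

/-- In `y` the function is quadratic with Hessian `μ I`, so the second-order expansion is exact and
strong convexity holds with equality. -/
lemma lowerG_expand (x y₁ y₂ : E d) :
    lowerG μ β (pt x y₂) + inner ℝ (gradY (lowerG μ β) (pt x y₂)) (y₁ - y₂) +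
      μ / 2 * ‖y₁ - y₂‖ ^ 2 = lowerG μ β (pt x y₁) := by
  rw [gradY_lowerG, EuclideanSpace.real_norm_sq_eq, PiLp.inner_apply, lowerG, lowerG,
    Finset.mul_sum, ← Finset.sum_add_distrib, ← Finset.sum_add_distrib]
  refine Finset.sum_congr rfl fun i _ => ?_
  simp
  ring

/-- The `y`-gradient vanishes at `α • x`, so the exact expansion there leaves only a square, and the
minimizer is unique. -/
lemma lowerSol_lowerG {α : ℝ} (hμ : 0 < μ) (hβ : β = α * μ) {Y : Set (E d)} {x : E d}
    (hx : α • x ∈ Y) : lowerSol (lowerG μ β) Y x = α • x := by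
  have key : ∀ y, lowerG μ β (pt x (α • x)) + μ / 2 * ‖y - α • x‖ ^ 2 = lowerG μ β (pt x y) :=
      fun y => by
    have h0 : gradY (lowerG μ β) (pt x (α • x)) = 0 := by
      rw [gradY_lowerG, pt_fst, pt_snd, hβ]; module
    rw [← lowerG_expand x y (α • x), h0, inner_zero_left, add_zero]
  have hex : ∃ y, y ∈ Y ∧ IsMinOn (fun y' => lowerG μ β (pt x y')) Y y :=
    ⟨α • x, hx, fun y _ => by
      have := key y
      have : 0 ≤ μ / 2 * ‖y - α • x‖ ^ 2 := by positivity
      change lowerG μ β (pt x (α • x)) ≤ lowerG μ β (pt x y)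
      linarith⟩
  have h2 := (Classical.epsilon_spec hex).2 hx
  change lowerG μ β (pt x (lowerSol (lowerG μ β) Y x)) ≤ lowerG μ β (pt x (α • x)) at h2
  have h3 := key (lowerSol (lowerG μ β) Y x)
  have h4 : ‖lowerSol (lowerG μ β) Y x - α • x‖ ^ 2 ≤ 0 := by
    by_contra! h
    have := mul_pos (half_pos hμ) h
    linarith
  exact sub_eq_zero.1 (norm_eq_zero.1 (pow_eq_zero_iff two_ne_zero |>.1
    (le_antisymm h4 (sq_nonneg _))))

/-- The derivative of `gradY (lowerG μ β)`, which is constant. -/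
lemma hasFDerivAt_gradY_lowerG (z : Pt d d) : HasFDerivAt (gradY (lowerG μ β))
    (μ • WithLp.sndL 2 ℝ (E d) (E d) - β • WithLp.fstL 2 ℝ (E d) (E d)) z := by
  have : gradY (lowerG μ β) = μ • WithLp.sndL 2 ℝ (E d) (E d) - β • WithLp.fstL 2 ℝ (E d) (E d) :=
    funext fun z => gradY_lowerG z
  rw [this]
  exact ContinuousLinearMap.hasFDerivAt _

lemma fderiv_gradY_lowerG_sub (z z' : Pt d d) :
    fderiv ℝ (gradY (lowerG μ β)) z - fderiv ℝ (gradY (lowerG μ β)) z' = 0 := by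
  have : ContinuousSMul ℝ (Pt d d) := IsBoundedSMul.continuousSMul
  exact sub_eq_zero.2 ((hasFDerivAt_gradY_lowerG z).fderiv.trans
    (hasFDerivAt_gradY_lowerG z').fderiv.symm)

end Lower

/-! ### Oracles -/

section Oracles

/-- The Bernoulli law on `Bool` with success probability `p`. -/
noncomputable def bernoulliLaw (p : ℝ) : Measure Bool :=
  ENNReal.ofReal p • Measure.dirac true + ENNReal.ofReal (1 - p) • Measure.dirac false

variable {p : ℝ}

lemma isProbabilityMeasure_bernoulliLaw (h0 : 0 ≤ p) (h1 : p ≤ 1) :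
    IsProbabilityMeasure (bernoulliLaw p) := ⟨by
  simp [bernoulliLaw, ← ENNReal.ofReal_add h0 (sub_nonneg.2 h1)]⟩

lemma integral_bernoulliLaw {F : Type*} [NormedAddCommGroup F] [NormedSpace ℝ F] [CompleteSpace F]
    (h0 : 0 ≤ p) (h1 : p ≤ 1) (φ : Bool → F) :
    ∫ b, φ b ∂bernoulliLaw p = p • φ true + (1 - p) • φ false := by
  have hi : ∀ b, Integrable φ (Measure.dirac b) := fun b => Integrable.of_finite
  rw [bernoulliLaw, integral_add_measure ((hi _).smul_measure ENNReal.ofReal_ne_top)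
    ((hi _).smul_measure ENNReal.ofReal_ne_top), integral_smul_measure, integral_smul_measure,
    integral_dirac, integral_dirac, ENNReal.toReal_ofReal h0, ENNReal.toReal_ofReal (by linarith)]

variable {m n d : ℕ}

/-- The oracle that returns a given vector field without noise. -/
noncomputable def exactOracle (G : Pt m n → Pt m n) (hG : Measurable G) : StochasticOracle m n where
  Seed := Unit
  law := Measure.dirac ()
  grad z _ := G z
  measurable_grad := hG.comp measurable_fst

lemma exactOracle_isOracleFor {f : Pt m n → ℝ} {G : Pt m n → Pt m n} (hG : Measurable G)
    (h : ∀ z, HasGradientAt f (G z) z) (D : Set (Pt m n)) (σ : ℝ) :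
    (exactOracle G hG).IsOracleFor f D σ where
  integrable z _ := integrable_const (G z)
  unbiased z _ := by rw [(h z).gradient]; exact integral_dirac (fun _ : Unit => G z) ()
  integrable_sq z _ := by
    rw [(h z).gradient]
    exact integrable_const (‖G z - G z‖ ^ 2)
  variance_le z _ := by
    rw [(h z).gradient]
    refine (integral_dirac (fun _ : Unit => ‖G z - G z‖ ^ 2) ()).trans_le ?_
    simpa using sq_nonneg σ

/-- `i` is the last index in the support of `x`. -/
def IsLast (x : E d) (i : Fin d) : Prop := x i ≠ 0 ∧ ∀ k, i < k → x k = 0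

lemma IsLast.eq {x : E d} {i j : Fin d} (hi : IsLast x i) (hj : IsLast x j) : i = j :=
  le_antisymm (not_lt.1 fun h => hi.1 (hj.2 i h)) (not_lt.1 fun h => hj.1 (hi.2 j h))

open Classical in
/-- The random factor on the lower-level partial derivatives: only the last active coordinate is
randomized. -/
noncomputable def noiseFactor (p : ℝ) (x : E d) (j : Fin d) (b : Bool) : ℝ :=
  if IsLast x j then (if b then 1 / p else 0) else 1

/-- The noisy version of `lowerGrad`. -/
noncomputable def noisyGrad (μ β p : ℝ) (z : Pt d d) (b : Bool) : Pt d d :=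
  pt (-β • z.snd) (WithLp.toLp 2 fun j => noiseFactor p z.fst j b * (μ * z.snd j - β * z.fst j))

lemma measurableSet_isLast (i : Fin d) : MeasurableSet {x : E d | IsLast x i} := by
  have : {x : E d | IsLast x i} = {x | x i = 0}ᶜ ∩ ⋂ k, ⋂ (_ : i < k), {x | x k = 0} := by
    ext; simp [IsLast]
  rw [this]
  have h : ∀ k, MeasurableSet {x : E d | x k = 0} := fun k =>
    measurableSet_eq_fun (by fun_prop) measurable_const
  exact (h i).compl.inter (MeasurableSet.iInter fun k => MeasurableSet.iInter fun _ => h k)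

lemma measurable_noisyGrad (μ β p : ℝ) :
    Measurable (Function.uncurry (noisyGrad (d := d) μ β p)) := by
  refine measurable_from_prod_countable_left fun b => ?_
  have hx : Measurable fun z : Pt d d => z.fst := (WithLp.fstL 2 ℝ (E d) (E d)).measurable
  have hy : Measurable fun z : Pt d d => z.snd := (WithLp.sndL 2 ℝ (E d) (E d)).measurable
  refine (WithLp.measurable_toLp 2 _).comp (Measurable.prodMk (hy.const_smul (-β)) ?_)
  refine (WithLp.measurable_toLp 2 _).comp (measurable_pi_lambda _ fun j => ?_)
  refine Measurable.mul ?_ ?_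
  · exact Measurable.ite (p := fun z : Pt d d => IsLast z.fst j) (hx (measurableSet_isLast j))
      (measurable_const (a := if b then 1 / p else 0)) measurable_const
  · have hxj : Measurable fun z : Pt d d => z.fst j := (coordX j).measurable
    have hyj : Measurable fun z : Pt d d => z.snd j := (coordY j).measurable
    fun_prop

/-- The randomized oracle for the lower-level function. -/
noncomputable def bernoulliOracle (μ β p : ℝ) (h0 : 0 ≤ p) (h1 : p ≤ 1) :
    StochasticOracle d d where
  Seed := Bool
  law := bernoulliLaw p
  isProbabilityMeasure := isProbabilityMeasure_bernoulliLaw h0 h1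
  grad := noisyGrad μ β p
  measurable_grad := measurable_noisyGrad μ β p

lemma noisyGrad_mean {μ β : ℝ} (h0 : 0 < p) (z : Pt d d) :
    p • noisyGrad μ β p z true + (1 - p) • noisyGrad μ β p z false = lowerGrad μ β z := by
  refine WithLp.ofLp_injective 2 (Prod.ext ?_ ?_)
  · change p • (-β • z.snd) + (1 - p) • (-β • z.snd) = -β • z.snd
    module
  · ext j
    change p * (noiseFactor p z.fst j true * (μ * z.snd j - β * z.fst j)) +
      (1 - p) * (noiseFactor p z.fst j false * (μ * z.snd j - β * z.fst j)) =
      μ * z.snd j - β * z.fst j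
    unfold noiseFactor
    split_ifs <;> simp_all
    · field_simp
    · ring

/-- The last active index is unique, so the error has at most one nonzero entry. -/
lemma norm_noisyGrad_sub_sq_le {μ β b : ℝ} {z : Pt d d} (s : Bool)
    (hb : ∀ j, (μ * z.snd j - β * z.fst j) ^ 2 ≤ b ^ 2) :
    ‖noisyGrad μ β p z s - lowerGrad μ β z‖ ^ 2 ≤ ((if s then 1 / p else 0) - 1) ^ 2 * b ^ 2 := by
  rw [norm_sq_joint]
  have h1 : ∀ i, (noisyGrad μ β p z s - lowerGrad μ β z).fst i = 0 := fun i =>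
    sub_self ((-β • z.snd) i)
  have h2 : ∀ j, (noisyGrad μ β p z s - lowerGrad μ β z).snd j =
      (noiseFactor p z.fst j s - 1) * (μ * z.snd j - β * z.fst j) := fun j => by
    change noiseFactor p z.fst j s * (μ * z.snd j - β * z.fst j) -
      (μ * z.snd j - β * z.fst j) = _
    ring
  simp only [h1, h2]
  rw [show ∑ _x : Fin d, (0 : ℝ) ^ 2 = 0 by simp, zero_add]
  by_cases hl : ∃ i, IsLast z.fst i
  · obtain ⟨i, hi⟩ := hl
    rw [Finset.sum_eq_single i]
    · rw [noiseFactor, if_pos hi, mul_pow]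
      exact mul_le_mul_of_nonneg_left (hb i) (sq_nonneg _)
    · intro j _ hj
      rw [noiseFactor, if_neg fun h => hj (h.eq hi)]
      ring
    · simp
  · push Not at hl
    rw [Finset.sum_eq_zero fun j _ => by rw [noiseFactor, if_neg (hl j)]; ring]
    positivity

lemma bernoulliOracle_isOracleFor {μ β b σ : ℝ} (h0 : 0 < p) (h1 : p ≤ 1) {D : Set (Pt d d)}
    (hb : ∀ z ∈ D, ∀ j, (μ * z.snd j - β * z.fst j) ^ 2 ≤ b ^ 2)
    (hσ : (1 - p) / p * b ^ 2 ≤ σ ^ 2) :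
    (bernoulliOracle μ β p h0.le h1).IsOracleFor (lowerG μ β) D σ where
  integrable z _ := by
    have := isProbabilityMeasure_bernoulliLaw h0.le h1
    exact Integrable.of_finite (μ := bernoulliLaw p) (f := noisyGrad μ β p z)
  unbiased z _ := by
    rw [(hasGradientAt_lowerG μ β z).gradient, ← noisyGrad_mean h0 z]
    exact integral_bernoulliLaw h0.le h1 _
  integrable_sq z _ := by
    have := isProbabilityMeasure_bernoulliLaw h0.le h1
    exact Integrable.of_finite (μ := bernoulliLaw p)
      (f := fun s => ‖noisyGrad μ β p z s - ∇ (lowerG μ β) z‖ ^ 2)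
  variance_le z hz := by
    rw [(hasGradientAt_lowerG μ β z).gradient]
    refine (integral_bernoulliLaw h0.le h1
      (fun s => ‖noisyGrad μ β p z s - lowerGrad μ β z‖ ^ 2)).trans_le (le_trans ?_ hσ)
    have ht := norm_noisyGrad_sub_sq_le (p := p) true (hb z hz)
    have hf := norm_noisyGrad_sub_sq_le (p := p) false (hb z hz)
    simp only [if_true, Bool.false_eq_true, if_false] at ht hf
    have h1' : 0 ≤ 1 - p := by linarith
    calc _ ≤ p * ((1 / p - 1) ^ 2 * b ^ 2) + (1 - p) * ((0 - 1) ^ 2 * b ^ 2) := by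
          simp only [smul_eq_mul]; gcongr
      _ = (1 - p) / p * b ^ 2 := by field_simp; ring

end Oracles

/-! ### The hyper-objective -/

section Hyper

variable {N : ℕ} (lam s α : ℝ)

/-- The hyper-objective of the chain function when the lower-level solution is `α x`. -/
noncomputable def chainH (x : E (N + 1)) : ℝ := chainF lam s (α * s) (pt x (α • x))

/-- The gradient of `chainH`. -/
noncomputable def chainHGrad (x : E (N + 1)) : E (N + 1) :=
  (chainGrad lam s (α * s) (pt x (α • x))).fst + α • (chainGrad lam s (α * s) (pt x (α • x))).snd

lemma hasGradientAt_chainH (x : E (N + 1)) :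
    HasGradientAt (chainH lam s α) (chainHGrad lam s α x) x :=
  hasGradientAt_graph (hasGradientAt_chainF lam s (α * s) _)

variable {lam s α}

lemma chainH_eq (hα : 0 < α) (x : E (N + 1)) : chainH lam s α x =
    -(lam * ((1 + x 0 / s) + ∑ j : Fin N, sqPos (x j.castSucc / s) * (1 + x j.succ / s))) := by
  simp [chainH, chainF, mul_div_mul_left _ _ hα.ne']

/-- The contribution through `y*` carries a factor `1 + x/s`, nonnegative on the cube; it can only
push the derivative further down and never cancels the direct part. -/
lemma chainHGrad_zero_le (hlam : 0 < lam) (hs : 0 < s) (hα : 0 < α) {x : E (N + 1)}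
    (hx : x ∈ cube (N + 1) s) : chainHGrad lam s α x 0 ≤ -(lam / s) := by
  have h : (chainGrad lam s (α * s) (pt x (α • x))).snd 0 ≤ 0 := by
    rcases N with _ | N
    · exact (chainGrad_snd_last lam s (α * s) _).le
    · rw [show (0 : Fin (N + 1 + 1)) = Fin.castSucc 0 from rfl, chainGrad_snd_castSucc]
      have h1 := (div_mem_of_mem_cube hs hx (Fin.succ 0)).1
      have h2 : 0 ≤ 1 + x (Fin.succ 0) / s := by linarith
      have h3 : 0 ≤ max (α * x (Fin.castSucc 0) / (α * s)) 0 := le_max_right _ _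
      have h4 : 0 ≤ 2 * lam / (α * s) := by positivity
      simpa using mul_nonneg h4 (mul_nonneg h3 h2)
  have := mul_nonpos_of_nonneg_of_nonpos hα.le h
  simpa [chainHGrad] using this

lemma chainHGrad_succ_le (hlam : 0 < lam) (hs : 0 < s) (hα : 0 < α) {x : E (N + 1)}
    (hx : x ∈ cube (N + 1) s) (j : Fin N) :
    chainHGrad lam s α x j.succ ≤ -(lam / s * sqPos (x j.castSucc / s)) := by
  have h : (chainGrad lam s (α * s) (pt x (α • x))).snd j.succ ≤ 0 := by
    generalize j.succ = i
    induction i using Fin.lastCases with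
    | last => exact (chainGrad_snd_last lam s (α * s) _).le
    | cast i =>
      rw [chainGrad_snd_castSucc]
      have h1 := (div_mem_of_mem_cube hs hx i.succ).1
      have h2 : 0 ≤ 1 + x i.succ / s := by linarith
      have h3 : 0 ≤ max (α * x i.castSucc / (α * s)) 0 := le_max_right _ _
      have h4 : 0 ≤ 2 * lam / (α * s) := by positivity
      simpa using mul_nonneg h4 (mul_nonneg h3 h2)
  have := mul_nonpos_of_nonneg_of_nonpos hα.le h
  simpa [chainHGrad, mul_div_mul_left _ _ hα.ne'] using this

lemma chainHGrad_succ_of_eq_zero {x : E (N + 1)} (hα : 0 < α) (j : Fin N) (h : x j.succ = 0) :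
    chainHGrad lam s α x j.succ = -(lam / s * sqPos (x j.castSucc / s)) := by
  have h : (chainGrad lam s (α * s) (pt x (α • x))).snd j.succ = 0 := by
    generalize j.succ = i at h
    induction i using Fin.lastCases with
    | last => exact chainGrad_snd_last lam s (α * s) _
    | cast i => rw [chainGrad_snd_castSucc]; simp [h]
  simp [chainHGrad, mul_div_mul_left _ _ hα.ne', h]

/-- As long as the last coordinate is inactive, some coordinate of the gradient is large and points
into the cube. -/
lemma exists_chainHGrad_le (hlam : 0 < lam) (hs : 0 < s) (hα : 0 < α) {x : E (N + 1)}
    (hx : x ∈ cube (N + 1) s) (hlast : x (Fin.last N) = 0) :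
    ∃ i, x i ≤ s / 2 ∧ chainHGrad lam s α x i ≤ -(lam / (4 * s)) := by
  by_contra! hc
  -- If the claim failed, activity would propagate: the first derivative is always large, and `x j >
  -- s/2` makes the next one at least `lam/(4s)` in size, so every coordinate, the last included,
  -- would exceed `s/2`.
  have key : ∀ i, s / 2 < x i := fun i => by
    induction i using Fin.induction with
    | zero =>
      by_contra! h
      have h1 := hc 0 h
      have h2 := chainHGrad_zero_le hlam hs hα hx
      have h3 : lam / (4 * s) = lam / s / 4 := by ring
      have : 0 < lam / s := by positivity
      linarith
    | succ j ih =>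
      by_contra! h
      have h1 := hc j.succ h
      have h2 := chainHGrad_succ_le hlam hs hα hx j
      have h3 : lam / (4 * s) = lam / s * (1 / 2) ^ 2 := by ring
      have h4 : (1 / 2 : ℝ) ^ 2 ≤ sqPos (x j.castSucc / s) := by
        refine pow_le_pow_left₀ (by norm_num) (le_max_of_le_left ?_) 2
        rw [le_div_iff₀ hs]; linarith
      have : lam / s * (1 / 2) ^ 2 ≤ lam / s * sqPos (x j.castSucc / s) := by gcongr
      linarith
  have := key (Fin.last N)
  linarith

lemma continuous_chainHGrad : Continuous (chainHGrad (N := N) lam s α) := by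
  have hx : ∀ i : Fin (N + 1), Continuous fun x : E (N + 1) => x i := fun i => by fun_prop
  refine Continuous.add ?_ (Continuous.const_smul ?_ α) <;>
    refine (PiLp.continuous_toLp 2 _).comp (continuous_pi fun i => ?_)
  · refine Fin.cases ?_ (fun j => ?_) i
    · exact continuous_const
    · simp only [Fin.cons_succ, sqPos, pt_snd, PiLp.smul_apply, smul_eq_mul]
      have := hx j.castSucc
      fun_prop
  · refine Fin.lastCases ?_ (fun j => ?_) i
    · simpa using continuous_const
    · simp only [Fin.snoc_castSucc, pt_snd, pt_fst, PiLp.smul_apply, smul_eq_mul]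
      have := hx j.castSucc
      have := hx j.succ
      fun_prop

lemma norm_pt_smul_le (hα : 0 ≤ α) (x : E N) : ‖pt x (α • x)‖ ≤ (1 + α) * ‖x‖ := by
  refine abs_le_of_sq_le_sq' ?_ (by positivity) |>.2
  rw [WithLp.prod_norm_sq_eq_of_L2, pt_fst, pt_snd, norm_smul, Real.norm_of_nonneg hα]
  nlinarith [mul_nonneg hα (sq_nonneg ‖x‖)]

lemma norm_fst_le {m n : ℕ} (z : Pt m n) : ‖z.fst‖ ≤ ‖z‖ := by
  refine abs_le_of_sq_le_sq' ?_ (norm_nonneg _) |>.2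
  rw [WithLp.prod_norm_sq_eq_of_L2 z]
  linarith [sq_nonneg ‖z.snd‖]

lemma norm_snd_le {m n : ℕ} (z : Pt m n) : ‖z.snd‖ ≤ ‖z‖ := by
  refine abs_le_of_sq_le_sq' ?_ (norm_nonneg _) |>.2
  rw [WithLp.prod_norm_sq_eq_of_L2 z]
  linarith [sq_nonneg ‖z.fst‖]

lemma pt_smul_mem_dom (hα : 0 ≤ α) {x : E N} (hx : x ∈ cube N s) :
    pt x (α • x) ∈ dom (cube N s) (cube N (α * s)) := ⟨hx, smul_mem_cube hα hx⟩

lemma chainHGrad_lipschitz (hα : 0 ≤ α) {L : ℝ} (hL0 : 0 ≤ L)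
    (hL : ∀ z ∈ dom (cube (N + 1) s) (cube (N + 1) (α * s)),
      ∀ z' ∈ dom (cube (N + 1) s) (cube (N + 1) (α * s)),
      ‖chainGrad lam s (α * s) z - chainGrad lam s (α * s) z'‖ ≤ L * ‖z - z'‖)
    {x x' : E (N + 1)} (hx : x ∈ cube (N + 1) s) (hx' : x' ∈ cube (N + 1) s) :
    ‖chainHGrad lam s α x - chainHGrad lam s α x'‖ ≤ (1 + α) * (L * (1 + α)) * ‖x - x'‖ := by
  set w := chainGrad lam s (α * s) (pt x (α • x)) - chainGrad lam s (α * s) (pt x' (α • x')) with hw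
  have h1 : chainHGrad lam s α x - chainHGrad lam s α x' = w.fst + α • w.snd := by
    rw [hw, WithLp.sub_fst, WithLp.sub_snd, chainHGrad, chainHGrad]; module
  have h2 : ‖w‖ ≤ L * ((1 + α) * ‖x - x'‖) := by
    refine (hL _ (pt_smul_mem_dom hα hx) _ (pt_smul_mem_dom hα hx')).trans ?_
    have : pt x (α • x) - pt x' (α • x') = pt (x - x') (α • (x - x')) := by
      rw [smul_sub]; rfl
    rw [this]
    exact mul_le_mul_of_nonneg_left (norm_pt_smul_le hα _) hL0
  calc _ ≤ ‖w.fst‖ + ‖α • w.snd‖ := h1 ▸ norm_add_le _ _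
    _ = ‖w.fst‖ + α * ‖w.snd‖ := by rw [norm_smul, Real.norm_of_nonneg hα]
    _ ≤ ‖w‖ + α * ‖w‖ := by gcongr; exacts [norm_fst_le w, norm_snd_le w]
    _ = (1 + α) * ‖w‖ := by ring
    _ ≤ (1 + α) * (L * ((1 + α) * ‖x - x'‖)) := by gcongr
    _ = _ := by ring

lemma neg_le_chainH (hlam : 0 < lam) (hs : 0 < s) (hα : 0 < α) {x : E (N + 1)}
    (hx : x ∈ cube (N + 1) s) : -(lam * (2 * (N + 1))) ≤ chainH lam s α x := by
  rw [chainH_eq hα, neg_le_neg_iff]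
  have h0 := div_mem_of_mem_cube hs hx
  have h : ∑ j : Fin N, sqPos (x j.castSucc / s) * (1 + x j.succ / s) ≤ ∑ _j : Fin N, (2 : ℝ) := by
    refine Finset.sum_le_sum fun j _ => ?_
    calc _ ≤ (1 : ℝ) * 2 := mul_le_mul (sqPos_le_one (h0 _).2) (by linarith [(h0 j.succ).2])
            (by linarith [(h0 j.succ).1]) zero_le_one
      _ = 2 := by norm_num
  simp only [Finset.sum_const, Finset.card_univ, Fintype.card_fin, nsmul_eq_mul] at h
  gcongr
  linarith [(h0 0).2]

lemma chainH_corner (hs : 0 < s) (hα : 0 < α) :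
    chainH (N := N) lam s α (WithLp.toLp 2 fun _ => s) = -(lam * (2 * (N + 1))) := by
  rw [chainH_eq hα]
  simp only [div_self hs.ne', sqPos_one, Finset.sum_const, Finset.card_univ, Fintype.card_fin,
    nsmul_eq_mul]
  ring

variable {H : E (N + 1) → ℝ}

lemma gradientWithin_eq_chainHGrad (hs : 0 < s)
    (hH : ∀ x ∈ cube (N + 1) s, H x = chainH lam s α x) {x : E (N + 1)}
    (hx : x ∈ cube (N + 1) s) :
    gradientWithin H (cube (N + 1) s) x = chainHGrad lam s α x := by
  have h := (hasGradientAt_iff_hasFDerivAt.1 (hasGradientAt_chainH lam s α x)).hasFDerivWithinAt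
    (s := cube (N + 1) s)
  rw [gradientWithin, (h.congr hH (hH x hx)).fderivWithin (uniqueDiffOn_cube hs x hx),
    LinearIsometryEquiv.symm_apply_apply]

lemma isSmoothOn_of_eq_chainH (hs : 0 < s) (hα : 0 ≤ α) {L : ℝ} (hL0 : 0 ≤ L)
    (hL : ∀ z ∈ dom (cube (N + 1) s) (cube (N + 1) (α * s)),
      ∀ z' ∈ dom (cube (N + 1) s) (cube (N + 1) (α * s)),
      ‖chainGrad lam s (α * s) z - chainGrad lam s (α * s) z'‖ ≤ L * ‖z - z'‖)
    (hH : ∀ x ∈ cube (N + 1) s, H x = chainH lam s α x) :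
    IsSmoothOn H (cube (N + 1) s) ((1 + α) * (L * (1 + α))) := by
  refine ⟨fun x hx => ?_, fun x hx x' hx' => ?_⟩
  · exact ((hasGradientAt_chainH lam s α x).differentiableAt.differentiableWithinAt).congr hH
      (hH x hx)
  · rw [gradientWithin_eq_chainHGrad hs hH hx, gradientWithin_eq_chainHGrad hs hH hx']
    exact chainHGrad_lipschitz hα hL0 hL hx hx'

/-- The hyper-objective cannot be smoother than its curvature along the first coordinate. -/
lemma le_smoothness_of_eq_chainH (hN : 0 < N) (hlam : 0 < lam) (hs : 0 < s) (hα : 0 < α)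
    (hH : ∀ x ∈ cube (N + 1) s, H x = chainH lam s α x) {L : ℝ}
    (hL : IsSmoothOn H (cube (N + 1) s) L) : lam / s ≤ L * s := by
  let j : Fin N := ⟨0, hN⟩
  have hj : j.castSucc = 0 := rfl
  have hj' : j.succ ≠ 0 := Fin.succ_ne_zero j
  -- Between `0` and this point, at distance `s`, the derivative in coordinate `1` drops from `0` to
  -- `-lam/s`.
  let e : E (N + 1) := EuclideanSpace.single 0 s
  have he0 : e 0 = s := by simp [e]
  have hej : e j.succ = 0 := by simp [e, hj']
  have he : e ∈ cube (N + 1) s := fun i => by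
    rcases eq_or_ne i 0 with rfl | h
    · rw [he0, abs_of_pos hs]
    · simp [e, h, hs.le]
  have h0 : (0 : E (N + 1)) ∈ cube (N + 1) s := zero_mem_cube hs.le
  have h := hL.2 e he 0 h0
  rw [gradientWithin_eq_chainHGrad hs hH he, gradientWithin_eq_chainHGrad hs hH h0, sub_zero,
    PiLp.norm_single, Real.norm_of_nonneg hs.le] at h
  refine le_trans ?_ h
  have h1 := PiLp.norm_apply_le (chainHGrad lam s α e - chainHGrad lam s α 0) j.succ
  rw [PiLp.sub_apply, chainHGrad_succ_of_eq_zero hα j hej, chainHGrad_succ_of_eq_zero hα j rfl, hj,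
    he0, div_self hs.ne'] at h1
  simpa [abs_of_pos hlam, abs_of_pos hs] using h1

lemma gradMapNorm_eq (hs : 0 < s) (hH : ∀ x ∈ cube (N + 1) s, H x = chainH lam s α x) {L : ℝ}
    {x : E (N + 1)} (hx : x ∈ cube (N + 1) s) :
    gradMapNorm H (cube (N + 1) s) L x =
      L * ‖clamp s (x - (1 / L) • chainHGrad lam s α x) - x‖ := by
  rw [gradMapNorm, gradientWithin_eq_chainHGrad hs hH hx, proj_cube hs.le]

/-- Any admissible `L` is at least `lam/s²`, so a step of length `c/L ≤ s/4` from a coordinate at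
most `s/2` stays inside the box and truncation cannot shorten the move below it. -/
lemma le_gradMapNorm (hN : 0 < N) (hlam : 0 < lam) (hs : 0 < s) (hα : 0 < α)
    (hH : ∀ x ∈ cube (N + 1) s, H x = chainH lam s α x) {L : ℝ} (hL0 : 0 < L)
    (hL : IsSmoothOn H (cube (N + 1) s) L) {x : E (N + 1)} (hx : x ∈ cube (N + 1) s)
    (hlast : x (Fin.last N) = 0) :
    lam / (4 * s) ≤ gradMapNorm H (cube (N + 1) s) L x := by
  have h1 := le_smoothness_of_eq_chainH hN hlam hs hα hH hL
  obtain ⟨i, hi, hg⟩ := exists_chainHGrad_le hlam hs hα hx hlast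
  rw [gradMapNorm_eq hs hH hx, ← div_le_iff₀' hL0]
  set c := lam / (4 * s) with hc
  have hc' : lam / s = 4 * c := by rw [hc]; field_simp
  have h2 : c / L ≤ s / 4 := by rw [div_le_iff₀ hL0]; linarith
  have h3 := PiLp.norm_apply_le (clamp s (x - (1 / L) • chainHGrad lam s α x) - x) i
  refine le_trans ?_ h3
  rw [PiLp.sub_apply, clamp_apply, PiLp.sub_apply, PiLp.smul_apply, smul_eq_mul]
  refine le_trans ?_ (le_abs_self _)
  have h4 : c / L ≤ -(1 / L * chainHGrad lam s α x i) := by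
    rw [div_eq_mul_one_div, mul_comm, ← mul_neg]
    have : 0 < 1 / L := by positivity
    gcongr
    linarith
  have h5 : x i + c / L ≤ max (-s) (min (x i - 1 / L * chainHGrad lam s α x i) s) :=
    le_max_of_le_right (le_min (by linarith) (by linarith))
  linarith

end Hyper

/-! ### Progress of a zero-respecting run -/

section Progress

variable {N : ℕ} {lam s r μ β p : ℝ}

/-- The lower-level coordinates of `z` are inactive from `k` on, the upper-level ones from `k + 1`
on. -/
def InactiveFrom (k : ℕ) (z : Pt (N + 1) (N + 1)) : Prop :=
  (∀ j : Fin (N + 1), k + 1 ≤ j → z.fst j = 0) ∧ ∀ j : Fin (N + 1), k ≤ j → z.snd j = 0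

lemma InactiveFrom.chainGrad {k : ℕ} {z : Pt (N + 1) (N + 1)} (h : InactiveFrom k z) :
    InactiveFrom k (chainGrad lam s r z) := by
  refine ⟨fun j hj => ?_, fun j hj => ?_⟩
  · induction j using Fin.cases with
    | zero => simp at hj
    | succ i =>
      have := h.2 i.castSucc (by simpa using hj)
      simp [this]
  · induction j using Fin.lastCases with
    | last => simp
    | cast i => simp [h.2 i.castSucc hj]

lemma InactiveFrom.noisyGrad {k : ℕ} {z : Pt (N + 1) (N + 1)} (h : InactiveFrom k z) (b : Bool) :
    InactiveFrom (k + if b then 1 else 0) (noisyGrad μ β p z b) := by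
  refine ⟨fun j hj => ?_, fun j hj => ?_⟩
  · have := h.2 j (by omega)
    simp [Bilevel.noisyGrad, this]
  · have hy := h.2 j (by omega)
    by_cases hx : z.fst j = 0
    · simp [Bilevel.noisyGrad, hx, hy]
    -- The frontier coordinate: if `x k` is active it is the last active one, so a failed draw
    -- erases exactly the entry that would activate `y k`.
    · have hj' : (j : ℕ) = k := by
        have := mt (h.1 j) hx
        omega
      cases b
      · have : IsLast z.fst j := ⟨hx, fun i hi => h.1 i (by
          have : (j : ℕ) < i := hi
          omega)⟩
        simp [Bilevel.noisyGrad, noiseFactor, this]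
      · simp at hj; omega

lemma InactiveFrom.mono {k l : ℕ} (hkl : k ≤ l) {z : Pt (N + 1) (N + 1)} (h : InactiveFrom k z) :
    InactiveFrom l z := ⟨fun j hj => h.1 j (by omega), fun j hj => h.2 j (by omega)⟩

/-- The number of successes among the first `t` seeds. -/
def successes {Ω : Type*} (b : ℕ → Ω → Bool) (t : ℕ) (ω : Ω) : ℕ :=
  ∑ i ∈ Finset.range t, if b i ω then 1 else 0

lemma successes_mono {Ω : Type*} (b : ℕ → Ω → Bool) (ω : Ω) : Monotone fun t => successes b t ω :=
  fun _ _ h => Finset.sum_le_sum_of_subset (Finset.range_mono h)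

lemma successes_succ {Ω : Type*} (b : ℕ → Ω → Bool) (t : ℕ) (ω : Ω) :
    successes b (t + 1) ω = successes b t ω + if b t ω then 1 else 0 := Finset.sum_range_succ _ _

variable {Ω : Type*} [mΩ : MeasurableSpace Ω] {P : Measure Ω}
  {ℱ : Filtration ℕ mΩ} {x y : ℕ → Ω → E (N + 1)} {hG : Measurable (chainGrad (N := N) lam s r)}
  {h0 : 0 ≤ p} {h1 : p ≤ 1}
  {sf : ℕ → Ω → (exactOracle (chainGrad (N := N) lam s r) hG).Seed}
  {sg : ℕ → Ω → (bernoulliOracle (d := N + 1) μ β p h0 h1).Seed} {Rx Ry : ℝ}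

/-- Strong induction, since a step may use all earlier answers. Projection onto a cube centred at
`0` activates no new coordinate. The bound is pathwise, so it holds however the queries adapt to
earlier answers. -/
lemma ZeroRespectingRun.ae_inactiveFrom (hRx : 0 ≤ Rx) (hRy : 0 ≤ Ry)
    (hrun : ZeroRespectingRun (exactOracle (chainGrad (N := N) lam s r) hG)
      (bernoulliOracle (d := N + 1) μ β p h0 h1) (cube (N + 1) Rx) (cube (N + 1) Ry) P ℱ sf sg x y) :
    ∀ᵐ ω ∂P, ∀ t, InactiveFrom (successes sg t ω) (pt (x t ω) (y t ω)) := by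
  filter_upwards [ae_all_iff.2 hrun.step_x, ae_all_iff.2 hrun.step_y] with ω hx hy
  intro t
  induction t using Nat.strong_induction_on with
  | _ t ih =>
    rcases t with _ | t
    · exact ⟨fun j _ => by simp [hrun.init_x ω], fun j _ => by simp [hrun.init_y ω]⟩
    · obtain ⟨u, hu, hu'⟩ := hx t
      obtain ⟨v, hv, hv'⟩ := hy t
      have hi : ∀ i ≤ t, InactiveFrom (successes sg (t + 1) ω) (pt (x i ω) (y i ω)) := fun i hi =>
        (ih i (by omega)).mono (successes_mono sg ω (by omega))
      have hn : ∀ i ≤ t, InactiveFrom (successes sg (t + 1) ω)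
          (Bilevel.noisyGrad μ β p (pt (x i ω) (y i ω)) (sg i ω)) := fun i hi =>
        ((ih i (by omega)).noisyGrad (sg i ω)).mono
          ((successes_succ sg i ω).ge.trans (successes_mono sg ω (by omega)))
      refine ⟨fun j hj => ?_, fun j hj => ?_⟩
      · rw [pt_fst, hu, proj_cube hRx]
        refine clamp_apply_eq_zero hRx (by_contra fun hne => ?_)
        obtain ⟨i, hit, hmem⟩ := Set.mem_iUnion₂.1 (hu' hne)
        rcases hmem with (h | h) | h
        · exact h ((hi i hit).1 j hj)
        · exact h ((hi i hit).chainGrad.1 j hj)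
        · exact h ((hn i hit).1 j hj)
      · rw [pt_snd, hv, proj_cube hRy]
        refine clamp_apply_eq_zero hRy (by_contra fun hne => ?_)
        obtain ⟨i, hit, hmem⟩ := Set.mem_iUnion₂.1 (hv' hne)
        rcases hmem with (h | h) | h
        · exact h ((hi i hit).2 j hj)
        · exact h ((hi i hit).chainGrad.2 j hj)
        · exact h ((hn i hit).2 j hj)

lemma ZeroRespectingRun.ae_mem_cube {m n : ℕ} {Of Og : StochasticOracle m n} {Y : Set (E n)}
    {sf : ℕ → Ω → Of.Seed} {sg : ℕ → Ω → Og.Seed} {x : ℕ → Ω → E m} {y : ℕ → Ω → E n}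
    (hRx : 0 ≤ Rx) (hrun : ZeroRespectingRun Of Og (cube m Rx) Y P ℱ sf sg x y) (t : ℕ) :
    ∀ᵐ ω ∂P, x t ω ∈ cube m Rx := by
  rcases t with _ | t
  · exact Filter.Eventually.of_forall fun ω => by
      rw [hrun.init_x ω]; exact zero_mem_cube hRx
  · filter_upwards [hrun.step_x t] with ω hω
    obtain ⟨u, hu, -⟩ := hω
    rw [hu, proj_cube hRx]
    exact clamp_mem_cube hRx u

lemma ZeroRespectingRun.map_lower_seed {m n : ℕ} {Of Og : StochasticOracle m n} {X : Set (E m)}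
    {Y : Set (E n)} {sf : ℕ → Ω → Of.Seed} {sg : ℕ → Ω → Og.Seed} {x : ℕ → Ω → E m}
    {y : ℕ → Ω → E n} (hrun : ZeroRespectingRun Of Og X Y P ℱ sf sg x y) (t : ℕ) :
    Measurable (sg t) ∧ P.map (sg t) = Og.law := by
  have hf : Measurable (sf t) := (hrun.measurable_sf t).mono (ℱ.le _) le_rfl
  have hg : Measurable (sg t) := (hrun.measurable_sg t).mono (ℱ.le _) le_rfl
  refine ⟨hg, ?_⟩
  have h := congrArg (Measure.map Prod.snd) (hrun.law_seeds t)
  rw [Measure.map_map measurable_snd (hf.prodMk hg), Measure.map_snd_prod, measure_univ,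
    one_smul] at h
  exact h

lemma integrable_success [IsProbabilityMeasure P] {b : Ω → Bool} (hb : Measurable b) :
    Integrable (fun ω => if b ω then (1 : ℝ) else 0) P := by
  refine Integrable.of_bound (C := 1)
    ((measurable_of_finite fun c : Bool => if c then (1 : ℝ) else 0).comp hb).aestronglyMeasurable
    (Filter.Eventually.of_forall fun ω => ?_)
  cases b ω <;> simp

lemma integral_success (h0 : 0 ≤ p) (h1 : p ≤ 1) {b : Ω → Bool} (hb : Measurable b)
    (hlaw : P.map b = bernoulliLaw p) : ∫ ω, (if b ω then (1 : ℝ) else 0) ∂P = p := by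
  have h := integral_map (μ := P) hb.aemeasurable (f := fun c : Bool => if c then (1 : ℝ) else 0)
    (measurable_of_finite _).aestronglyMeasurable
  rw [← h, hlaw, integral_bernoulliLaw h0 h1]
  simp

lemma integral_successes [IsProbabilityMeasure P] (h0 : 0 ≤ p) (h1 : p ≤ 1) {b : ℕ → Ω → Bool}
    (hb : ∀ i, Measurable (b i) ∧ P.map (b i) = bernoulliLaw p) (t : ℕ) :
    Integrable (fun ω => (successes b t ω : ℝ)) P ∧ ∫ ω, (successes b t ω : ℝ) ∂P = t * p := by
  have h : ∀ ω, (successes b t ω : ℝ) = ∑ i ∈ Finset.range t, if b i ω then (1 : ℝ) else 0 :=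
    fun ω => by simp [successes]
  simp only [h]
  refine ⟨integrable_finsetSum _ fun i _ => integrable_success (hb i).1, ?_⟩
  rw [integral_finsetSum _ fun i _ => integrable_success (hb i).1,
    Finset.sum_congr rfl fun i _ => integral_success h0 h1 (hb i).1 (hb i).2]
  simp

/-- The expected gradient mapping along a run decreases at most linearly. -/
lemma ZeroRespectingRun.le_integral_gradMapNorm [IsProbabilityMeasure P] {α : ℝ} (hN : 0 < N)
    (hlam : 0 < lam) (hs : 0 < s) (hα : 0 < α) (hRy : 0 ≤ Ry)
    (hrun : ZeroRespectingRun (exactOracle (chainGrad (N := N) lam s r) hG)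
      (bernoulliOracle (d := N + 1) μ β p h0 h1) (cube (N + 1) s) (cube (N + 1) Ry) P ℱ sf sg x y)
    {H : E (N + 1) → ℝ} (hH : ∀ x ∈ cube (N + 1) s, H x = chainH lam s α x) {L : ℝ} (hL0 : 0 < L)
    (hL : IsSmoothOn H (cube (N + 1) s) L) (t : ℕ) :
    lam / (4 * s) * (1 - t * p / N) ≤ ∫ ω, gradMapNorm H (cube (N + 1) s) L (x t ω) ∂P := by
  have hmem := hrun.ae_mem_cube hs.le t
  -- Integrability goes through this explicit formula, which agrees with `gradMapNorm` on the cube,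
  -- where the iterates lie almost surely.
  have hcont : Continuous fun x : E (N + 1) =>
      L * ‖clamp s (x - (1 / L) • chainHGrad lam s α x) - x‖ := by
    have h1 := continuous_chainHGrad (N := N) (lam := lam) (s := s) (α := α)
    have h2 := continuous_clamp (d := N + 1) (R := s)
    fun_prop
  have hint : Integrable (fun ω => gradMapNorm H (cube (N + 1) s) L (x t ω)) P := by
    obtain ⟨C, hC⟩ := (isCompact_cube (d := N + 1) (R := s)).exists_bound_of_continuousOn
      hcont.continuousOn
    have hx : Measurable (x t) := (hrun.adapted_x t).mono (ℱ.le t) le_rfl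
    refine (Integrable.of_bound (C := C) (hcont.measurable.comp hx).aestronglyMeasurable ?_).congr ?_
    · filter_upwards [hmem] with ω hω using hC _ hω
    · filter_upwards [hmem] with ω hω using (gradMapNorm_eq hs hH hω).symm
  obtain ⟨hi, hS⟩ := integral_successes (b := sg) h0 h1 (fun i => hrun.map_lower_seed i) t
  have hN' : (0 : ℝ) < N := by exact_mod_cast hN
  calc lam / (4 * s) * (1 - t * p / N)
      = ∫ ω, lam / (4 * s) * (1 - successes sg t ω / N) ∂P := by
        rw [integral_const_mul, integral_sub (integrable_const _) (hi.div_const _),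
          integral_div, hS]
        simp
    _ ≤ _ := by
        refine integral_mono_ae (((integrable_const _).sub (hi.div_const _)).const_mul _) hint ?_
        filter_upwards [hmem, hrun.ae_inactiveFrom hs.le hRy] with ω hω hin
        have hc : 0 < lam / (4 * s) := by positivity
        -- Markov's inequality done pointwise: with fewer than `N` successes coordinate `N` is still
        -- zero, and otherwise `1 - successes / N` is nonpositive.
        by_cases h : successes sg t ω < N
        · refine le_trans ?_ (le_gradMapNorm hN hlam hs hα hH hL0 hL hω
            ((hin t).1 (Fin.last N) (by simpa using h)))
          have : 0 ≤ (successes sg t ω : ℝ) / N := by positivity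
          nlinarith
        · have h1 : (1 : ℝ) ≤ successes sg t ω / N := by
            rw [one_le_div hN']; exact_mod_cast not_lt.1 h
          have h2 : 0 ≤ gradMapNorm H (cube (N + 1) s) L (x t ω) :=
            mul_nonneg hL0.le (norm_nonneg _)
          nlinarith

end Progress

/-! ### The hard instance -/

section Instance

variable {N : ℕ} {lam s α μ : ℝ}

lemma hyperObj_chain (hα : 0 ≤ α) (hμ : 0 < μ) {x : E (N + 1)} (hx : x ∈ cube (N + 1) s) :
    hyperObj (chainF lam s (α * s)) (lowerG μ (α * μ)) (cube (N + 1) (α * s)) x =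
      chainH lam s α x := by
  rw [hyperObj, lowerSol_lowerG hμ rfl (smul_mem_cube hα hx), chainH]

/-- The second derivatives of `g` are constant, hence `ρ = 0`. The minimum of `H` is at the corner
with all entries `s`, with gap `2 lam (N + 1) - lam`. -/
lemma bilevelClass_chain {Lf Lg Δ C : ℝ} (hlam : 0 < lam) (hs : 0 < s) (hα : 0 < α) (hμ : 0 < μ)
    (hLf : lam / s / (α * s) * 6 + lam / (α * s) ^ 2 * 6 ≤ Lf) (hLg : μ + α * μ ≤ Lg)
    (hΔ : lam * (2 * N + 1) ≤ Δ) (hC0 : 0 ≤ C) (hC : N * (4 * lam / (α * s)) ^ 2 ≤ C ^ 2) :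
    BilevelClass Lf Lg μ Δ C 0 (cube (N + 1) s) (cube (N + 1) (α * s))
      (chainF lam s (α * s)) (lowerG μ (α * μ)) where
  closed_X := isClosed_cube
  convex_X := convex_cube
  zero_mem_X := zero_mem_cube hs.le
  closed_Y := isClosed_cube
  convex_Y := convex_cube
  nonempty_Y := ⟨0, zero_mem_cube (by positivity)⟩
  smooth_f := .of_hasGradientAt (hasGradientAt_chainF lam s (α * s)) fun z hz z' hz' =>
    chainGrad_lipschitz hlam hs (by positivity) hLf z z' hz hz'
  smooth_g := .of_hasGradientAt (hasGradientAt_lowerG μ (α * μ)) fun z _ z' _ => by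
    rw [lowerGrad_sub]
    exact (norm_lowerGrad_le hμ.le (by positivity) _).trans (by gcongr)
  bounded_gradY z hz := by
    rw [gradY, (hasGradientAt_chainF lam s (α * s) z).gradient]
    exact abs_le_of_sq_le_sq' ((norm_chainGrad_snd_le hlam hs (by positivity) hz).trans hC) hC0 |>.2
  strongly_convex x _ y₁ _ y₂ _ := (lowerG_expand x y₁ y₂).le
  second_order z _ := (hasFDerivAt_gradY_lowerG z).differentiableAt
  second_order_lipschitz z _ z' _ := by
    rw [fderiv_gradY_lowerG_sub, norm_zero, zero_mul]
  gap := by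
    have hc : WithLp.toLp 2 (fun _ => s) ∈ cube (N + 1) s := fun _ => (abs_of_pos hs).le
    refine ⟨_, hc, fun x hx => ?_, ?_⟩
    · rw [Set.mem_ofPred_eq, hyperObj_chain hα.le hμ hc, hyperObj_chain hα.le hμ hx,
        chainH_corner hs hα]
      exact neg_le_chainH hlam hs hα hx
    · rw [hyperObj_chain hα.le hμ hc, hyperObj_chain hα.le hμ (zero_mem_cube hs.le),
        chainH_corner hs hα, chainH_eq hα]
      simp
      linarith

/-- A success probability for which the Bernoulli noise on a quantity of size `b` has variance
`σ²`. -/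
lemma exists_bernoulli_parameter {b σ : ℝ} (hb : 0 < b) (hσ : 0 < σ) :
    ∃ p : ℝ, 0 < p ∧ p ≤ 1 ∧ p * σ ^ 2 ≤ b ^ 2 ∧ (1 - p) / p * b ^ 2 ≤ σ ^ 2 := by
  -- The solution of `(1 - p)/p * b² = σ²`; it is below `1` however `b` and `σ` compare.
  refine ⟨b ^ 2 / (b ^ 2 + σ ^ 2), by positivity, ?_, ?_, le_of_eq ?_⟩
  · rw [div_le_one (by positivity)]
    linarith [sq_nonneg σ]
  · rw [div_mul_eq_mul_div, div_le_iff₀ (by positivity)]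
    gcongr
    linarith [sq_nonneg b]
  · field_simp; ring

lemma le_calls_of_expectation_lt {N t p ε lam b Δ σ : ℝ} (hN : 0 < N) (ht : 0 ≤ t) (hε : 0 < ε)
    (hlam : 0 < lam) (hΔ : Δ ≤ 8 * lam * N) (hpb : p * σ ^ 2 ≤ b ^ 2)
    (h : 2 * ε * (1 - t * p / N) < ε) : Δ * σ ^ 2 ≤ 16 * lam * b ^ 2 * t := by
  have h2 : 1 / 2 < t * p / N := by
    by_contra! h'
    have : 2 * ε * (1 - 1 / 2) ≤ 2 * ε * (1 - t * p / N) := by gcongr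
    linarith
  rw [lt_div_iff₀ hN] at h2
  calc Δ * σ ^ 2 ≤ 8 * lam * N * σ ^ 2 := by gcongr
    _ ≤ 8 * lam * (2 * (t * p)) * σ ^ 2 := by gcongr; linarith
    _ = 16 * lam * t * (p * σ ^ 2) := by ring
    _ ≤ 16 * lam * t * b ^ 2 := by gcongr
    _ = _ := by ring

lemma le_calls_of_parameters {c D Lf Lg μ Δ ε σ α s lam b t : ℝ} (hc : 0 < c) (hD : 0 < D)
    (hLf : 0 < Lf) (hLg : 0 < Lg) (hμ : 0 < μ) (hΔ : 0 < Δ) (hε : 0 < ε) (hκ : 1 ≤ Lg / μ)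
    (hα : α = c * (Lg / μ)) (hs : s = 8 * D * ε / (Lf * α)) (hlam : lam = 8 * ε * s)
    (hb : b = 2 * (α * μ) * s) (h : Δ * σ ^ 2 ≤ 16 * lam * b ^ 2 * t) :
    c / (2 ^ 18 * D ^ 3) * (Lf ^ 3 * Δ * (Lg / μ) ^ (5 / 2 : ℝ) * σ ^ 2 / (Lg ^ 2 * ε ^ 4)) ≤ t := by
  -- The parameters give the exponent `3`; the stated one is weaker.
  have h4 : (Lg / μ) ^ (5 / 2 : ℝ) ≤ (Lg / μ) ^ 3 := by
    rw [← Real.rpow_natCast]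
    exact Real.rpow_le_rpow_of_exponent_le hκ (by norm_num)
  have hα0 : 0 < α := by rw [hα]; positivity
  have hs0 : 0 < s := by rw [hs]; positivity
  have hlam0 : 0 < lam := by rw [hlam]; positivity
  have hb0 : 0 < b := by rw [hb]; positivity
  calc c / (2 ^ 18 * D ^ 3) * (Lf ^ 3 * Δ * (Lg / μ) ^ (5 / 2 : ℝ) * σ ^ 2 / (Lg ^ 2 * ε ^ 4))
      ≤ c / (2 ^ 18 * D ^ 3) * (Lf ^ 3 * Δ * (Lg / μ) ^ 3 * σ ^ 2 / (Lg ^ 2 * ε ^ 4)) := by gcongr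
    _ = Δ * σ ^ 2 / (16 * lam * b ^ 2) := by
      rw [hb, hlam, hs, hα]; field_simp; ring
    _ ≤ t := by rw [div_le_iff₀' (by positivity)]; exact h

end Instance

end Bilevel

/-! ### Choice of the parameters and conclusion. -/

set_option maxHeartbeats 800000 in
open Bilevel in
theorem theorem2 (κ₀ : ℝ) (hκ₀ : 1 < κ₀) :
    ∃ c₀ > (0 : ℝ), ∃ c₁ > (0 : ℝ), ∀ B > (0 : ℝ), ∃ K > (0 : ℝ), ∃ ρ ≥ (0 : ℝ),
    ∀ Lf Lg μ Δ ε σ : ℝ, 0 < Lf → 0 < Lg → 0 < μ → 0 < Δ → 0 < ε → 0 < σ →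
      κ₀ ≤ Lg / μ → Δ / Lf ≤ B → ε ≤ c₁ * Real.sqrt (Lg / μ * Lf * Δ) →
    ∃ (m n : ℕ) (Rx Ry : ℝ) (f g : Bilevel.Pt m n → ℝ) (Of Og : Bilevel.StochasticOracle m n),
      0 < Rx ∧ 0 < Ry ∧
      Bilevel.BilevelClass Lf Lg μ Δ (K * Lf) ρ (Bilevel.cube m Rx) (Bilevel.cube n Ry) f g ∧
      Of.IsOracleFor f (Bilevel.dom (Bilevel.cube m Rx) (Bilevel.cube n Ry)) σ ∧
      Og.IsOracleFor g (Bilevel.dom (Bilevel.cube m Rx) (Bilevel.cube n Ry)) σ ∧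
      (∃ Lh > (0 : ℝ),
        Bilevel.IsSmoothOn (Bilevel.hyperObj f g (Bilevel.cube n Ry)) (Bilevel.cube m Rx) Lh) ∧
      ∀ Lh > (0 : ℝ),
        Bilevel.IsSmoothOn (Bilevel.hyperObj f g (Bilevel.cube n Ry)) (Bilevel.cube m Rx) Lh →
        ∀ (Ω : Type*) [mΩ : MeasurableSpace Ω] (P : MeasureTheory.Measure Ω)
          [MeasureTheory.IsProbabilityMeasure P] (ℱ : MeasureTheory.Filtration ℕ mΩ)
          (sf : ℕ → Ω → Of.Seed) (sg : ℕ → Ω → Og.Seed)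
          (x : ℕ → Ω → Bilevel.E m) (y : ℕ → Ω → Bilevel.E n),
          Bilevel.ZeroRespectingRun Of Og (Bilevel.cube m Rx) (Bilevel.cube n Ry) P ℱ sf sg x y →
          ∀ t : ℕ,
            ∫ ω, Bilevel.gradMapNorm (Bilevel.hyperObj f g (Bilevel.cube n Ry))
              (Bilevel.cube m Rx) Lh (x t ω) ∂P < ε →
            c₀ * (Lf ^ 3 * Δ * (Lg / μ) ^ (5 / 2 : ℝ) * σ ^ 2 / (Lg ^ 2 * ε ^ 4)) ≤ (t : ℝ) := by
  have hκ₀' : 0 < κ₀ - 1 := by linarith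
  -- The largest `c` with `μ + c κ μ ≤ Lg` for all `κ ≥ κ₀`.
  set c := 1 - 1 / κ₀ with hc
  have hc0 : 0 < c := by rw [hc, sub_pos, div_lt_one (by linarith)]; exact hκ₀
  have hcκ₀ : c * κ₀ = κ₀ - 1 := by rw [hc]; field_simp
  -- Chosen so that `6α + 6 ≤ D α` whenever `α ≥ κ₀ - 1`, which is the smoothness budget of `f`.
  set D := 6 + 6 / (κ₀ - 1) with hD
  have hD0 : 0 < D := by positivity
  refine ⟨c / (2 ^ 18 * D ^ 3), by positivity, √(c / (256 * D)), by positivity, fun B hB =>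
    ⟨√B, by positivity, 0, le_rfl, ?_⟩⟩
  intro Lf Lg μ Δ ε σ hLf hLg hμ hΔ hε hσ hκ hB' hε'
  set κ := Lg / μ with hκd
  have hκ0 : 0 < κ := by positivity
  set α := c * κ with hα
  have hα0 : 0 < α := by positivity
  have hακ₀ : κ₀ - 1 ≤ α := by rw [← hcκ₀, hα]; gcongr
  have hDα : 6 * α + 6 ≤ D * α := by
    have : 6 / (κ₀ - 1) * (κ₀ - 1) ≤ 6 / (κ₀ - 1) * α := by gcongr
    rw [div_mul_cancel₀ _ hκ₀'.ne'] at this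
    rw [hD, add_mul]
    linarith
  -- The scale for which `lam/(s · α s) = Lf/D`, once `lam = 8 ε s` fixes the gradient level
  -- `lam/(4s)` at `2ε`.
  set s := 8 * D * ε / (Lf * α) with hs
  have hs0 : 0 < s := by positivity
  set lam := 8 * ε * s with hlam
  have hlam0 : 0 < lam := by positivity
  have hlams : lam / (4 * s) = 2 * ε := by rw [hlam]; field_simp; norm_num
  have hαs : lam / (α * s) ^ 2 = Lf / (D * α) := by rw [hlam, hs]; field_simp
  have h4 : 4 * lam ≤ Δ := by
    have h1 : ε ^ 2 ≤ c / (256 * D) * (κ * Lf * Δ) := by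
      have := pow_le_pow_left₀ hε.le hε' 2
      rwa [mul_pow, Real.sq_sqrt (by positivity), Real.sq_sqrt (by positivity)] at this
    have h2 : 4 * lam = 256 * D * ε ^ 2 / (Lf * α) := by rw [hlam, hs]; ring
    rw [h2, div_le_iff₀ (by positivity)]
    calc 256 * D * ε ^ 2 ≤ 256 * D * (c / (256 * D) * (κ * Lf * Δ)) := by gcongr
      _ = Δ * (Lf * α) := by rw [hα]; field_simp
  -- The gap `lam (2N + 1)` is at most `4 lam N ≤ Δ` once `N ≥ 1`; that the floor is positive is
  -- where the upper bound on `ε` enters.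
  set N := ⌊Δ / (4 * lam)⌋₊ with hN
  have hN0 : 0 < N := Nat.floor_pos.2 ((one_le_div (by positivity)).2 h4)
  have hN1 : (1 : ℝ) ≤ N := by exact_mod_cast hN0
  have hNle : 4 * lam * N ≤ Δ := by
    have := Nat.floor_le (a := Δ / (4 * lam)) (by positivity)
    rwa [le_div_iff₀' (by positivity)] at this
  have hNge : Δ ≤ 8 * lam * N := by
    have := (Nat.lt_floor_add_one (Δ / (4 * lam))).le
    rw [div_le_iff₀' (by positivity)] at this
    nlinarith
  set b := 2 * (α * μ) * s with hb
  have hb0 : 0 < b := by positivity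
  obtain ⟨p, hp0, hp1, hpb, hvar⟩ := exists_bernoulli_parameter hb0 hσ
  have hLfs : lam / s / (α * s) * 6 + lam / (α * s) ^ 2 * 6 ≤ Lf := by
    have h1 : lam / s / (α * s) = Lf / D := by rw [hlam, hs]; field_simp
    rw [h1, hαs]
    calc Lf / D * 6 + Lf / (D * α) * 6 = Lf * ((6 * α + 6) / (D * α)) := by field_simp
      _ ≤ Lf * 1 := by gcongr; rw [div_le_one (by positivity)]; exact hDα
      _ = Lf := mul_one _
  have hclass : BilevelClass Lf Lg μ Δ (√B * Lf) 0 (cube (N + 1) s) (cube (N + 1) (α * s))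
      (chainF lam s (α * s)) (lowerG μ (α * μ)) := by
    refine bilevelClass_chain hlam0 hs0 hα0 hμ hLfs ?_ ?_ (by positivity) ?_
    · have h1 : α * μ = Lg - Lg / κ₀ := by rw [hα, hκd, hc]; field_simp
      have h2 : μ ≤ Lg / κ₀ := by
        rw [le_div_iff₀ (by linarith)]
        rw [le_div_iff₀ hμ] at hκ
        linarith
      linarith
    · nlinarith
    -- The bound `Δ/Lf ≤ B` is needed here: the squared gradient bound is a multiple of `Δ Lf`, and
    -- `D α ≥ 6` supplies the constant.
    · rw [mul_pow, Real.sq_sqrt hB.le]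
      calc N * (4 * lam / (α * s)) ^ 2 = 4 * lam * N * 4 * (lam / (α * s) ^ 2) := by
            rw [div_pow]; ring
        _ ≤ Δ * 4 * (Lf / (D * α)) := by rw [hαs]; gcongr
        _ ≤ B * Lf * 4 * (Lf / 6) := by
            rw [div_le_iff₀ hLf] at hB'
            gcongr
            linarith
        _ ≤ B * Lf ^ 2 := by
            have : 0 < B * Lf ^ 2 := by positivity
            linarith
  have hH : ∀ x ∈ cube (N + 1) s,
      hyperObj (chainF lam s (α * s)) (lowerG μ (α * μ)) (cube (N + 1) (α * s)) x =
        chainH lam s α x := fun x hx => hyperObj_chain hα0.le hμ hx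
  refine ⟨N + 1, N + 1, s, α * s, chainF lam s (α * s), lowerG μ (α * μ),
    exactOracle (chainGrad lam s (α * s)) measurable_chainGrad,
    bernoulliOracle μ (α * μ) p hp0.le hp1, hs0, by positivity, hclass,
    exactOracle_isOracleFor _ (hasGradientAt_chainF lam s (α * s)) _ _,
    bernoulliOracle_isOracleFor (b := b) hp0 hp1 (fun z hz j => ?_) hvar, ?_, ?_⟩
  -- On the box, `|μ y j|` and `|α μ x j|` are both at most `α μ s`, whence the `2` in `b`.
  · have hx := mul_le_mul_of_nonneg_left (hz.1 j) (by positivity : 0 ≤ α * μ)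
    have hy := mul_le_mul_of_nonneg_left (hz.2 j) hμ.le
    refine sq_le_sq.2 ((abs_sub _ _).trans ?_)
    rw [abs_mul, abs_mul, abs_of_pos hμ, abs_of_pos (by positivity : 0 < α * μ), abs_of_pos hb0, hb]
    linarith
  · exact ⟨_, by positivity, isSmoothOn_of_eq_chainH hs0 hα0.le hLf.le
      (fun z hz z' hz' => chainGrad_lipschitz hlam0 hs0 (by positivity) hLfs z z' hz hz') hH⟩
  · intro Lh hLh hsm Ω _ P _ ℱ sf sg x y hrun t hlt
    have h1 := (hrun.le_integral_gradMapNorm hN0 hlam0 hs0 hα0 (by positivity) hH hLh hsm t).trans_lt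
      hlt
    rw [hlams] at h1
    exact le_calls_of_parameters hc0 hD0 hLf hLg hμ hΔ hε (hκ₀.le.trans hκ) hα hs hlam hb
      (le_calls_of_expectation_lt (by positivity) (by positivity) hε hlam0 hNge hpb h1)
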